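/- **Theorem (Schauder regularity (I)).** Let $d\ge 1$, $T>0$, $\alpha\in(1,2]$, $\beta\in[0,1]$ with $\alpha+\beta\notin\mathbb N$. Let $A\in\mathbb R^{d\times d}$ be symmetric and nonnegative definite, and let $\mu\ge 0$ be a Borel measure on $\mathbb R^d$ with $\int (1\wedge|z|^2)\,d\mu(z)<\infty$. Consider the Lévy operator $$\mathcal L\varphi(x)=\operatorname{div}(AD\varphi(x))+\int_{\mathbb R^d}\big[\varphi(x+z)-\varphi(x)-\mathbf 1_{|z|<1}D\varphi(x)\cdot z\big]\,d\mu(z).$$ Put $\psi(\xi)=\xi\cdot A\xi+\int_{\mathbb R^d}(1-e^{i\xi\cdot z}+i\xi\cdot z\,\mathbf 1_{|z|<1})\,d\mu(z)$. The heat kernel of $\mathcal L$ at time $t>0$ is the probability measure $p_t$ on $\mathbb R^d$ with $\int e^{-i\xi\cdot x}\,p_t(dx)=e^{-t\psi(\xi)}$ for all $\xi\in\mathbb R^d$. Assume: * **(L1)** for every $t>0$ the measure $p_t$ has a density, also denoted $p_t$, in $C_b^\infty(\mathbb R^d)$, and there is $c_0>0$ such that $\int_{\mathbb R^d}|Dp_t(y)|\,dy\le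 c_0t^{-1/\alpha}$ for $t\in(0,T]$; * **(H$_p$)** $H\colon[0,T]\times\mathbb R^d\times\mathbb R^d\to\mathbb R$ is continuous, and for each $R>0$ there are $H_0,L_R>0$ such that $|H(t,x,0)|\le H_0$ and $|H(t,x,p)-H(t,x,q)|\le L_R|p-q|$ for all $t\in(0,T)$, $x\in\mathbb R^d$ and $p,q\in B(0,R)$; * **(H$_x$)** for each $R>0$ there is $M_R>0$ such that $|H(t,x,p)-H(t,x',p)|\le M_R|x-x'|^\beta$ for all $t\in[0,T]$, $p\in B(0,R)$ and $x,x'\in\mathbb R^d$ with $|x-x'|<1$; * **(U$_0$)** $u_0\colon\mathbb R^d\to\mathbb R$ is bounded and Lipschitz. Write $P_t\varphi(x)=\int_{\mathbb R^d}p_t(x-y)\varphi(y)\,dy$. Let $u\in C_b((0,T];C_b^1(\mathbb R^d))$ be a mild solution of $\partial_tu-\mathcal Lu-H(t,x,Du)=0$, $u(0)=u_0$, that is, for all $t\in(0,T]$ and $x\in\mathbb R^d$ the following integral exists and $$u(t,x)=P_t[u_0](x)+\int_0^tP_{t-s}\big[H(s,\cdot,Du(s,\cdot))\big](x)\,ds.$$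 Here $D^k$ is the tensor of all spatial derivatives of order $k$; $C_b^n(\mathbb R^d)$ is the space of functions with continuous and bounded derivatives of orders $0,\dots,n$; $[f]_\theta=\sup_{x,\,h\neq0}|f(x+h)-f(x)|/|h|^\theta$; for $\gamma\notin\mathbb N$, $\gamma>0$, $f\in C_b^\gamma(\mathbb R^d)$ means that $f\in C_b^{\lfloor\gamma\rfloor}(\mathbb R^d)$ and $[D^{\lfloor\gamma\rfloor}f]_{\{\gamma\}}<\infty$, where $\{\gamma\}=\gamma-\lfloor\gamma\rfloor$. Then: 1. $u(t)\in C_b^{\alpha+\beta}(\mathbb R^d)$ for every $t\in(0,T]$; 2. $[D^{\lfloor\alpha+\beta\rfloor}u(t,\cdot)]_{\{\alpha+\beta\}}=O\big(t^{-(\alpha+\beta-1)/\alpha}\big)$ as $t\to0^+$; 3. if $\alpha+\beta>2$, then $\|D^2u(t,\cdot)\|_\infty=O(t^{-1/\alpha})$ as $t\to0^+$. -/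

import Mathlib

open Set Filter Topology MeasureTheory
open scoped NNReal ENNReal

/-- The Euclidean space `ℝᵈ`. -/
abbrev Euc (d : ℕ) : Type := EuclideanSpace ℝ (Fin d)

noncomputable section

/-! ### Sup norms, Hölder seminorms and the spaces `C_b^γ`

All norms take values in `[0, ∞]`, so that no value is junk. `D^k f` is the tensor
`iteratedFDeriv ℝ k f` of all derivatives of order `k`, with its operator norm (equivalent, with
constants depending on `d` and `k` only, to the maximum of the partial derivatives). -/

/-- `‖f‖_∞`. -/
def supNorm {d : ℕ} {F : Type*} [NormedAddCommGroup F] (f : Euc d → F) : ℝ≥0∞ :=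
  ⨆ x, ‖f x‖ₑ

/-- `[f]_θ`, the supremum of `|f (x + h) - f x| / |h| ^ θ` over `x` and `h ≠ 0`. -/
def holderSeminorm {d : ℕ} {F : Type*} [NormedAddCommGroup F] (θ : ℝ) (f : Euc d → F) : ℝ≥0∞ :=
  ⨆ (x : Euc d) (h : Euc d) (_ : h ≠ 0), ‖f (x + h) - f x‖ₑ / ENNReal.ofReal (‖h‖ ^ θ)

/-- `‖f‖_{C_b^n}`, the sum of the sup norms of the derivatives of order at most `n`. -/
def cbNorm {d : ℕ} (n : ℕ) (f : Euc d → ℝ) : ℝ≥0∞ :=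
  ∑ j ∈ Finset.range (n + 1), supNorm (iteratedFDeriv ℝ j f)

/-- `f ∈ C_b^n(ℝᵈ)`. -/
def IsCb {d : ℕ} (n : ℕ) (f : Euc d → ℝ) : Prop :=
  ContDiff ℝ n f ∧ cbNorm n f < ⊤

/-- `f ∈ C_b^γ(ℝᵈ)` for real `γ ≥ 0`: with `n = ⌊γ⌋`, `f ∈ C_b^n`, and if `γ` is not an integer,
`D^n f` is moreover Hölder continuous with exponent `γ - n`. -/
def IsCbHolder {d : ℕ} (γ : ℝ) (f : Euc d → ℝ) : Prop :=
  IsCb ⌊γ⌋₊ f ∧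
    (Int.fract γ ≠ 0 → holderSeminorm (Int.fract γ) (iteratedFDeriv ℝ ⌊γ⌋₊ f) < ⊤)

/-- `F(t) = O(g(t))` as `t → 0⁺`, for a `[0, ∞]`-valued `F` and a nonnegative `g`. -/
def BigOAtZero (F : ℝ → ℝ≥0∞) (g : ℝ → ℝ) : Prop :=
  ∃ C : ℝ≥0, ∀ᶠ t in 𝓝[>] (0 : ℝ), F t ≤ C * ENNReal.ofReal (g t)

/-! ### Lévy operators and their heat kernels -/

/-- `μ` is a Lévy measure: `∫ (1 ∧ |z|²) dμ(z) < ∞`. -/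
def IsLevyMeasure {d : ℕ} (μ : Measure (Euc d)) : Prop :=
  ∫⁻ z, ENNReal.ofReal (min 1 (‖z‖ ^ 2)) ∂μ < ⊤

/-- The symbol of (minus) the Lévy operator
`φ ↦ div (A Dφ) + ∫ (φ (x + z) - φ x - 1_{|z| < 1} Dφ x · z) dμ(z)`, namely
`ξ ↦ ξ · A ξ + ∫ (1 - e^{i ξ · z} + i ξ · z 1_{|z| < 1}) dμ(z)`. -/
def levySymbol {d : ℕ} (A : Matrix (Fin d) (Fin d) ℝ) (μ : Measure (Euc d)) (ξ : Euc d) : ℂ :=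
  ((dotProduct ξ.ofLp (A.mulVec ξ.ofLp) : ℝ) : ℂ) +
    ∫ z, (1 - Complex.exp (Complex.I * (inner ℝ ξ z : ℝ)) +
      (Metric.ball (0 : Euc d) 1).indicator
        (fun z => Complex.I * ((inner ℝ ξ z : ℝ) : ℂ)) z) ∂μ

/-- `ρ` is a density of the heat kernel at time `t`, that is of the probability measure on `ℝᵈ`
whose Fourier transform is `ξ ↦ e^{-t ψ(ξ)}` with `ψ = levySymbol A μ`. (The total mass is `1`
by the value at `ξ = 0`.) -/
structure IsHeatKernelDensity {d : ℕ} (A : Matrix (Fin d) (Fin d) ℝ) (μ : Measure (Euc d))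
    (t : ℝ) (ρ : Euc d → ℝ) : Prop where
  nonneg : ∀ x, 0 ≤ ρ x
  integrable : Integrable ρ
  fourier : ∀ ξ : Euc d,
    ∫ x, Complex.exp (-(Complex.I * (inner ℝ ξ x : ℝ))) * (ρ x : ℂ) =
      Complex.exp (-((t : ℂ) * levySymbol A μ ξ))

open scoped Classical in
/-- The heat kernel `p_t`: the continuous density of the probability measure with Fourier
transform `e^{-t ψ}`. There is at most one; the value is `0` if there is none. -/
def heatKernel {d : ℕ} (A : Matrix (Fin d) (Fin d) ℝ) (μ : Measure (Euc d)) (t : ℝ) :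
    Euc d → ℝ :=
  if h : ∃ ρ : Euc d → ℝ, Continuous ρ ∧ IsHeatKernelDensity A μ t ρ then h.choose else 0

/-- The heat semigroup `P_t φ = p_t * φ`, for `t > 0`. -/
def heatSemigroup {d : ℕ} (A : Matrix (Fin d) (Fin d) ℝ) (μ : Measure (Euc d)) (t : ℝ)
    (φ : Euc d → ℝ) (x : Euc d) : ℝ :=
  ∫ y, heatKernel A μ t (x - y) * φ y

/-- Nondegeneracy of order `α` of the Lévy operator with triplet `(A, 0, μ)`: the heat kernel is
absolutely continuous, its density `p_t` is in `C_b^∞`, and `∫ |Dp_t| ≤ c₀ t^{-1/α}` on `(0, T]`. -/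
structure NondegenerateOfOrder {d : ℕ} (A : Matrix (Fin d) (Fin d) ℝ) (μ : Measure (Euc d))
    (T α : ℝ) : Prop where
  density : ∀ t : ℝ, 0 < t → IsHeatKernelDensity A μ t (heatKernel A μ t)
  smooth : ∀ t : ℝ, 0 < t → ∀ n : ℕ, IsCb n (heatKernel A μ t)
  gradient_bound : ∃ c₀ : ℝ, 0 < c₀ ∧ ∀ t ∈ Ioc (0 : ℝ) T,
    ∫⁻ y, ‖gradient (heatKernel A μ t) y‖ₑ ≤ ENNReal.ofReal (c₀ * t ^ (-(1 / α)))

/-! ### Assumptions on the Hamiltonian, and mild solutions -/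

/-- `H` is continuous on `[0, T] × ℝᵈ × ℝᵈ`, bounded at `p = 0`, and locally Lipschitz in `p`
uniformly in `(t, x)`. -/
structure HamiltonianLipschitz {d : ℕ} (T : ℝ) (H : ℝ → Euc d → Euc d → ℝ) : Prop where
  continuousOn : ContinuousOn (fun z : ℝ × Euc d × Euc d => H z.1 z.2.1 z.2.2)
    (Icc (0 : ℝ) T ×ˢ univ)
  bounds : ∀ R : ℝ, 0 < R → ∃ H₀ L : ℝ, 0 < H₀ ∧ 0 < L ∧
    ∀ t ∈ Ioo (0 : ℝ) T, ∀ x : Euc d, |H t x 0| ≤ H₀ ∧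
      ∀ p ∈ Metric.ball (0 : Euc d) R, ∀ q ∈ Metric.ball (0 : Euc d) R,
        |H t x p - H t x q| ≤ L * ‖p - q‖

/-- `H` is `β`-Hölder in `x`, locally uniformly in `p`. -/
def HamiltonianHolder {d : ℕ} (T β : ℝ) (H : ℝ → Euc d → Euc d → ℝ) : Prop :=
  ∀ R : ℝ, 0 < R → ∃ M : ℝ, 0 < M ∧
    ∀ t ∈ Icc (0 : ℝ) T, ∀ p ∈ Metric.ball (0 : Euc d) R, ∀ x x' : Euc d,
      ‖x - x'‖ < 1 → |H t x p - H t x' p| ≤ M * ‖x - x'‖ ^ β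

/-- `u ∈ C((0, T]; C_b^1(ℝᵈ))`, with continuity in the norm of `C_b^1`. -/
def IsContinuousCbOne {d : ℕ} (T : ℝ) (u : ℝ → Euc d → ℝ) : Prop :=
  (∀ t ∈ Ioc (0 : ℝ) T, IsCb 1 (u t)) ∧
    ∀ t₀ ∈ Ioc (0 : ℝ) T,
      Tendsto (fun t => cbNorm 1 (fun x => u t x - u t₀ x)) (𝓝[Ioc (0 : ℝ) T] t₀) (𝓝 0)

/-- `u ∈ C_b((0, T]; C_b^1(ℝᵈ))`: moreover bounded in the norm of `C_b^1`. -/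
def IsBoundedContinuousCbOne {d : ℕ} (T : ℝ) (u : ℝ → Euc d → ℝ) : Prop :=
  IsContinuousCbOne T u ∧ ∃ M : ℝ≥0, ∀ t ∈ Ioc (0 : ℝ) T, cbNorm 1 (u t) ≤ M

/-- `u` is a mild solution on `(0, T]` of `∂ₜu - 𝓛u - H(t, x, Du) = 0`, `u(0) = u₀`: the Duhamel
integral exists and the Duhamel formula holds. -/
structure IsMildSolution {d : ℕ} (A : Matrix (Fin d) (Fin d) ℝ) (μ : Measure (Euc d)) (T : ℝ)
    (H : ℝ → Euc d → Euc d → ℝ) (u₀ : Euc d → ℝ) (u : ℝ → Euc d → ℝ) : Prop where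
  continuous : IsContinuousCbOne T u
  integrable : ∀ t ∈ Ioc (0 : ℝ) T, ∀ x : Euc d, IntervalIntegrable
    (fun s => heatSemigroup A μ (t - s) (fun y => H s y (gradient (u s) y)) x) volume 0 t
  duhamel : ∀ t ∈ Ioc (0 : ℝ) T, ∀ x : Euc d,
    u t x = heatSemigroup A μ t u₀ x +
      ∫ s in (0 : ℝ)..t, heatSemigroup A μ (t - s) (fun y => H s y (gradient (u s) y)) x

end

/-! Put `a = 1 / α`, so `0 < a < 1`. The kernel bound says that `P_t` turns a sup bound into a
Lipschitz bound at the cost `t ^ (-a)`. Together with translation invariance, sup-norm contraction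
and the semigroup law, this is all that is used of the Lévy operator (`IsSmoothingSemigroup`).
Interpolation at the length scale `r ^ a` shows that on `β`-Hölder data the `m`-th difference of
`P_r g` costs only `r ^ (-(a * (m - β)))` (`exists_fwdDiff_le_of_holder`).

The source `H(s, y, Du)` is as Hölder as `Du`, so the Hölder bound on `Du` must come first.
Differencing Duhamel's formula gives a linear Volterra inequality for `Δ_h Du`. An exponential
weight in time makes its kernel small, and the term is absorbed (`exists_holder_fderiv`), so the
source has `β`-Hölder constant `O(s ^ (-(a * β)))`.

The Schauder gain comes from one difference more than there are derivatives. The integrand has two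
bounds, an integrable one in `t - s` and a non-integrable one with a factor `‖h‖`. Cutting where
they cross yields exactly `‖h‖ ^ κ` with `κ` the fractional part of `α + β`
(`exists_abs_integral_le_min`); both sides of the cut converge because `0 < κ < 1`. The Lipschitz
datum gives the stated rates and the source is no more singular.

All estimates are on finite differences, which commute with `P_t` and with the time integral, so
nothing is differentiated under an integral. Derivatives are recovered at the end
(`differentiable_of_norm_fwdDiff_fwdDiff_le`, `regularity_of_fwdDiff_le`). -/

/-! ### Bounded continuous functions and abstract smoothing semigroups. -/

/-- `g` is continuous and bounded by `C` in absolute value. -/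
def BddCont {d : ℕ} (C : ℝ) (g : Euc d → ℝ) : Prop :=
  Continuous g ∧ ∀ x, |g x| ≤ C

lemma BddCont.fwdDiff {d : ℕ} {C : ℝ} {g : Euc d → ℝ} (hg : BddCont C g) (h : Euc d) :
    BddCont (2 * C) (fwdDiff h g) := by
  refine ⟨by have := hg.1; unfold _root_.fwdDiff; fun_prop, fun x => ?_⟩
  calc |g (x + h) - g x| ≤ |g (x + h)| + |g x| := abs_sub _ _
    _ ≤ 2 * C := by linarith [hg.2 (x + h), hg.2 x]

lemma BddCont.integrable_comp {d : ℕ} {C : ℝ} {g : Euc d → ℝ} (hg : BddCont C g)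
    (m : Measure (Euc d)) [IsFiniteMeasure m] {f : Euc d → Euc d} (hf : Continuous f) :
    Integrable (fun z => g (f z)) m :=
  Integrable.of_bound (hg.1.comp hf).aestronglyMeasurable C
    (Eventually.of_forall fun z => hg.2 (f z))

/-- A one-parameter semigroup on bounded continuous functions that commutes with translations and
gains one derivative at the cost of a factor `c * t ^ (-a)`. -/
structure IsSmoothingSemigroup {d : ℕ} (P : ℝ → (Euc d → ℝ) → Euc d → ℝ) (T a c : ℝ) : Prop where
  bddCont : ∀ {t C : ℝ} {g : Euc d → ℝ}, 0 < t → BddCont C g → BddCont C (P t g)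
  map_fwdDiff : ∀ {t C : ℝ} {g : Euc d → ℝ} (h : Euc d), 0 < t → BddCont C g →
    P t (fwdDiff h g) = fwdDiff h (P t g)
  add : ∀ {s t C : ℝ} {g : Euc d → ℝ}, 0 < s → 0 < t → BddCont C g → P (s + t) g = P s (P t g)
  gain : ∀ {t C : ℝ} {g : Euc d → ℝ}, 0 < t → t ≤ T → BddCont C g →
    ∀ h x, |fwdDiff h (P t g) x| ≤ c * t ^ (-a) * C * ‖h‖

/-! ### The heat semigroup is smoothing. -/

/-- The `L¹` modulus of continuity is controlled by the `L¹` norm of the gradient. -/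
lemma lintegral_enorm_add_sub_le {d : ℕ} {p : Euc d → ℝ} (hp : ContDiff ℝ 1 p) (k : Euc d) :
    ∫⁻ z, ‖p (z + k) - p z‖ₑ ≤ ‖k‖ₑ * ∫⁻ z, ‖gradient p z‖ₑ := by
  have hcont : Continuous (fderiv ℝ p) := hp.continuous_fderiv one_ne_zero
  -- Fundamental theorem of calculus along the segment from `z` to `z + k`; Tonelli and translation
  -- invariance then remove the parameter `s`.
  have hpt : ∀ z, ‖p (z + k) - p z‖ₑ ≤
      ∫⁻ s in Ioc (0 : ℝ) 1, ‖fderiv ℝ p (z + s • k)‖ₑ * ‖k‖ₑ := by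
    intro z
    have hd : ∀ s ∈ uIcc (0 : ℝ) 1,
        HasDerivAt (fun s : ℝ => p (z + s • k)) (fderiv ℝ p (z + s • k) k) s := by
      intro s _
      have h1 : HasDerivAt (fun s : ℝ => z + s • k) k s := by
        simpa using ((hasDerivAt_id s).smul_const k).const_add z
      exact ((hp.differentiable one_ne_zero) (z + s • k)).hasFDerivAt.comp_hasDerivAt s h1
    have hi : IntervalIntegrable (fun s : ℝ => fderiv ℝ p (z + s • k) k) volume 0 1 := by
      apply Continuous.intervalIntegrable
      fun_prop
    have h2 := intervalIntegral.integral_eq_sub_of_hasDerivAt hd hi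
    simp only [one_smul, zero_smul, add_zero] at h2
    rw [← h2, intervalIntegral.integral_of_le zero_le_one]
    refine (enorm_integral_le_lintegral_enorm _).trans (lintegral_mono fun s => ?_)
    exact ContinuousLinearMap.le_opENorm _ _
  calc ∫⁻ z, ‖p (z + k) - p z‖ₑ
      ≤ ∫⁻ z, ∫⁻ s in Ioc (0 : ℝ) 1, ‖fderiv ℝ p (z + s • k)‖ₑ * ‖k‖ₑ := lintegral_mono hpt
    _ = ∫⁻ s in Ioc (0 : ℝ) 1, ∫⁻ z, ‖fderiv ℝ p (z + s • k)‖ₑ * ‖k‖ₑ := by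
        apply lintegral_lintegral_swap
        apply Measurable.aemeasurable
        apply Continuous.measurable
        exact (ENNReal.continuous_mul_const enorm_ne_top).comp (by fun_prop)
    _ = ∫⁻ s in Ioc (0 : ℝ) 1, ‖k‖ₑ * ∫⁻ z, ‖gradient p z‖ₑ := by
        refine lintegral_congr fun s => ?_
        rw [lintegral_mul_const' _ _ enorm_ne_top, mul_comm,
          lintegral_add_right_eq_self (fun z => ‖fderiv ℝ p z‖ₑ)]
        congr 2
        ext z
        rw [gradient, LinearIsometryEquiv.enorm_map]
    _ = ‖k‖ₑ * ∫⁻ z, ‖gradient p z‖ₑ := by simp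

/-- The heat kernel as a measure. -/
noncomputable def heatMeasure {d : ℕ} (A : Matrix (Fin d) (Fin d) ℝ) (μ : Measure (Euc d)) (t : ℝ) :
    Measure (Euc d) :=
  volume.withDensity fun x => ENNReal.ofReal (heatKernel A μ t x)

section HeatMeasure

variable {d : ℕ} {A : Matrix (Fin d) (Fin d) ℝ} {μ : Measure (Euc d)} {T α : ℝ}

lemma NondegenerateOfOrder.continuous_heatKernel (hL : NondegenerateOfOrder A μ T α) {t : ℝ}
    (ht : 0 < t) : Continuous (heatKernel A μ t) :=
  (hL.smooth t ht 0).1.continuous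

lemma NondegenerateOfOrder.isFiniteMeasure (hL : NondegenerateOfOrder A μ T α) {t : ℝ}
    (ht : 0 < t) : IsFiniteMeasure (heatMeasure A μ t) :=
  isFiniteMeasure_withDensity_ofReal (hL.density t ht).integrable.2

lemma NondegenerateOfOrder.integral_heatMeasure (hL : NondegenerateOfOrder A μ T α) {t : ℝ}
    (ht : 0 < t) {F : Type*} [NormedAddCommGroup F] [NormedSpace ℝ F] (f : Euc d → F) :
    ∫ x, f x ∂(heatMeasure A μ t) = ∫ x, heatKernel A μ t x • f x := by
  rw [heatMeasure, integral_withDensity_eq_integral_toReal_smul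
    (hL.continuous_heatKernel ht).measurable.ennreal_ofReal (by simp)]
  simp only [ENNReal.toReal_ofReal ((hL.density t ht).nonneg _)]

/-- The sign of `ξ` flips because `charFun` integrates `e^{iξ·x}`, whereas the heat kernel is
normalised with `e^{-iξ·x}`. -/
lemma NondegenerateOfOrder.charFun_heatMeasure (hL : NondegenerateOfOrder A μ T α) {t : ℝ}
    (ht : 0 < t) (ξ : Euc d) :
    charFun (heatMeasure A μ t) ξ = Complex.exp (-((t : ℂ) * levySymbol A μ (-ξ))) := by
  rw [charFun_apply, hL.integral_heatMeasure ht, ← (hL.density t ht).fourier]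
  refine integral_congr_ae (Eventually.of_forall fun x => ?_)
  simp only [Complex.real_smul, inner_neg_left, real_inner_comm]
  rw [mul_comm]
  congr 2
  push_cast
  ring

lemma NondegenerateOfOrder.isProbabilityMeasure (hL : NondegenerateOfOrder A μ T α) {t : ℝ}
    (ht : 0 < t) : IsProbabilityMeasure (heatMeasure A μ t) := by
  have := hL.isFiniteMeasure ht
  have h := hL.charFun_heatMeasure ht 0
  rw [charFun_zero] at h
  have h0 : levySymbol A μ (-0) = 0 := by simp [levySymbol]
  rw [h0, mul_zero, neg_zero, Complex.exp_zero] at h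
  refine ⟨?_⟩
  have h1 : (heatMeasure A μ t).real univ = 1 := by exact_mod_cast h
  rw [Measure.real, ENNReal.toReal_eq_one_iff] at h1
  exact h1

/-- Chapman–Kolmogorov: the characteristic functions multiply, and they determine finite measures.
-/
lemma NondegenerateOfOrder.heatMeasure_add (hL : NondegenerateOfOrder A μ T α) {s t : ℝ}
    (hs : 0 < s) (ht : 0 < t) :
    heatMeasure A μ (s + t) = (heatMeasure A μ s).conv (heatMeasure A μ t) := by
  have := hL.isFiniteMeasure hs
  have := hL.isFiniteMeasure ht
  have := hL.isFiniteMeasure (add_pos hs ht)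
  apply Measure.ext_of_charFun
  ext ξ
  rw [charFun_conv, hL.charFun_heatMeasure hs, hL.charFun_heatMeasure ht,
    hL.charFun_heatMeasure (add_pos hs ht), ← Complex.exp_add]
  congr 1
  push_cast
  ring

lemma NondegenerateOfOrder.heatSemigroup_eq (hL : NondegenerateOfOrder A μ T α) {t : ℝ}
    (ht : 0 < t) (g : Euc d → ℝ) (x : Euc d) :
    heatSemigroup A μ t g x = ∫ z, g (x - z) ∂(heatMeasure A μ t) := by
  rw [hL.integral_heatMeasure ht, heatSemigroup, ← integral_sub_left_eq_self _ volume x]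
  simp

lemma NondegenerateOfOrder.isSmoothingSemigroup (hL : NondegenerateOfOrder A μ T α) :
    ∃ c, 0 < c ∧ IsSmoothingSemigroup (heatSemigroup A μ) T (1 / α) c := by
  obtain ⟨c, hc, hgrad⟩ := hL.gradient_bound
  have hfd : ∀ {t C : ℝ} {g : Euc d → ℝ} (h : Euc d), 0 < t → BddCont C g →
      heatSemigroup A μ t (fwdDiff h g) = fwdDiff h (heatSemigroup A μ t g) := by
    intro t C g h ht hg
    have := hL.isFiniteMeasure ht
    ext x
    simp only [fwdDiff, hL.heatSemigroup_eq ht]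
    rw [← integral_sub (hg.integrable_comp _ (by fun_prop)) (hg.integrable_comp _ (by fun_prop))]
    refine integral_congr_ae (Eventually.of_forall fun z => ?_)
    simp only [sub_add_eq_add_sub]
  refine ⟨c, hc, ?_, hfd, ?_, ?_⟩
  · intro t C g ht hg
    have := hL.isProbabilityMeasure ht
    refine ⟨?_, fun x => ?_⟩
    · have : heatSemigroup A μ t g = fun x => ∫ z, g (x - z) ∂(heatMeasure A μ t) :=
        funext (hL.heatSemigroup_eq ht g)
      rw [this]
      refine continuous_of_dominated (bound := fun _ => C) ?_ ?_ (integrable_const C) ?_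
      · exact fun x => (hg.1.comp (by fun_prop)).aestronglyMeasurable
      · exact fun x => Eventually.of_forall fun z => hg.2 _
      · exact Eventually.of_forall fun z => hg.1.comp (by fun_prop)
    · rw [hL.heatSemigroup_eq ht, ← Real.norm_eq_abs]
      refine (norm_integral_le_of_norm_le_const (C := C)
        (Eventually.of_forall fun z => hg.2 _)).trans ?_
      simp
  · intro s t C g hs ht hg
    have := hL.isFiniteMeasure hs
    have := hL.isFiniteMeasure ht
    ext x
    rw [hL.heatSemigroup_eq (add_pos hs ht), hL.heatMeasure_add hs ht,
      integral_conv (hg.integrable_comp _ (by fun_prop)), hL.heatSemigroup_eq hs]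
    refine integral_congr_ae (Eventually.of_forall fun z => ?_)
    simp only [hL.heatSemigroup_eq ht, sub_sub]
  · intro t C g ht htT hg h x
    have hC : 0 ≤ C := (abs_nonneg _).trans (hg.2 0)
    have hi := (hL.density t ht).integrable
    have hint : ∀ y : Euc d, Integrable (fun z => heatKernel A μ t (y - z) * g z) := fun y =>
      (hi.comp_sub_left y).mul_bdd hg.1.aestronglyMeasurable
        (Eventually.of_forall fun z => hg.2 z)
    have h1 : ‖fwdDiff h (heatSemigroup A μ t g) x‖ₑ ≤
        ENNReal.ofReal (c * t ^ (-(1 / α)) * C * ‖h‖) := by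
      -- The increment is put on the kernel, since `g` is only bounded and continuous.
      have h2 : fwdDiff h (heatSemigroup A μ t g) x =
          ∫ z, (heatKernel A μ t (x + h - z) - heatKernel A μ t (x - z)) * g z := by
        simp only [fwdDiff, heatSemigroup]
        rw [← integral_sub (hint _) (hint _)]
        simp only [sub_mul]
      rw [h2]
      calc _ ≤ ∫⁻ z, ‖(heatKernel A μ t (x + h - z) - heatKernel A μ t (x - z)) * g z‖ₑ :=
            enorm_integral_le_lintegral_enorm _
        _ ≤ ∫⁻ z, ‖heatKernel A μ t (x - z + h) - heatKernel A μ t (x - z)‖ₑ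
              * ENNReal.ofReal C := by
            refine lintegral_mono fun z => ?_
            rw [enorm_mul, sub_add_eq_add_sub]
            gcongr
            rw [← ofReal_norm]
            exact ENNReal.ofReal_le_ofReal (hg.2 z)
        _ = (∫⁻ z, ‖heatKernel A μ t (z + h) - heatKernel A μ t z‖ₑ) * ENNReal.ofReal C := by
            rw [lintegral_mul_const' _ _ ENNReal.ofReal_ne_top, lintegral_sub_left_eq_self
              (fun z => ‖heatKernel A μ t (z + h) - heatKernel A μ t z‖ₑ) x]
        _ ≤ (‖h‖ₑ * ENNReal.ofReal (c * t ^ (-(1 / α)))) * ENNReal.ofReal C := by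
            gcongr
            exact (lintegral_enorm_add_sub_le (hL.smooth t ht 1).1 h).trans
              (by gcongr; exact hgrad t ⟨ht, htT⟩)
        _ = ENNReal.ofReal (c * t ^ (-(1 / α)) * C * ‖h‖) := by
            rw [← ofReal_norm, ← ENNReal.ofReal_mul (norm_nonneg _),
              ← ENNReal.ofReal_mul (by positivity)]
            ring_nf
    rw [← ofReal_norm, Real.norm_eq_abs] at h1
    exact (ENNReal.ofReal_le_ofReal_iff (by positivity)).1 h1

end HeatMeasure

/-! ### Finite differences and the smoothing of Hölder functions. -/

lemma fwdDiff_comm {M G : Type*} [AddCommMonoid M] [AddCommGroup G] (h k : M) (v : M → G) :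
    fwdDiff h (fwdDiff k v) = fwdDiff k (fwdDiff h v) := by
  ext x
  simp only [fwdDiff, add_right_comm x h k]
  abel

/-- A long increment is `N` short ones plus second differences. Read backwards, it bounds a short
difference by a long one, which is cheap, and a sum of second differences. -/
lemma fwdDiff_natCast_smul {E F : Type*} [AddCommGroup E] [Module ℝ E] [AddCommGroup F]
    [Module ℝ F] (v : E → F) (h x : E) (N : ℕ) :
    fwdDiff ((N : ℝ) • h) v x =
      (N : ℝ) • fwdDiff h v x + ∑ j ∈ Finset.range N, fwdDiff ((j : ℝ) • h) (fwdDiff h v) x := by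
  induction N with
  | zero => simp [fwdDiff]
  | succ N ih =>
    rw [Finset.sum_range_succ]
    have h1 : fwdDiff (((N + 1 : ℕ) : ℝ) • h) v x =
        fwdDiff ((N : ℝ) • h) v x + fwdDiff h v (x + (N : ℝ) • h) := by
      simp only [fwdDiff, Nat.cast_add, Nat.cast_one, add_smul, one_smul, ← add_assoc]
      abel
    have h2 : fwdDiff ((N : ℝ) • h) (fwdDiff h v) x =
        fwdDiff h v (x + (N : ℝ) • h) - fwdDiff h v x := rfl
    rw [h1, ih, h2, Nat.cast_add, Nat.cast_one, add_smul, one_smul]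
    abel

namespace IsSmoothingSemigroup

variable {d : ℕ} {P : ℝ → (Euc d → ℝ) → Euc d → ℝ} {T a c β : ℝ}

/-- Interpolation between the sup and Lipschitz bounds. Beyond the length `ρ = r ^ a` the Hölder
bound inherited from `g` suffices; below it, the telescoping identity reaches the length `ρ`. -/
lemma fwdDiff_le_of_holder (hP : IsSmoothingSemigroup P T a c) (hc : 0 < c)
    (hβ : β ∈ Icc (0 : ℝ) 1) {r K C : ℝ} {g : Euc d → ℝ} (hr : 0 < r) (hrT : r ≤ T)
    (hg : BddCont C g) (hK : 0 ≤ K) (hgβ : ∀ h x, |fwdDiff h g x| ≤ K * ‖h‖ ^ β) (h x : Euc d) :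
    |fwdDiff h (P r g) x| ≤ 2 * (1 + c) * r ^ (-(a * (1 - β))) * K * ‖h‖ := by
  set ρ := r ^ a with hρ
  have hρ0 : 0 < ρ := Real.rpow_pos_of_pos hr a
  have hexp : r ^ (-(a * (1 - β))) = ρ ^ (β - 1) := by
    rw [hρ, ← Real.rpow_mul hr.le]
    ring_nf
  rw [hexp]
  have hBdd : ∀ k : Euc d, BddCont (K * ‖k‖ ^ β) (fwdDiff k g) :=
    fun k => ⟨(hg.fwdDiff k).1, hgβ k⟩
  have hΔ : ∀ k y : Euc d, |fwdDiff k (P r g) y| ≤ K * ‖k‖ ^ β := by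
    intro k y
    rw [← hP.map_fwdDiff k hr hg]
    exact (hP.bddCont hr (hBdd k)).2 y
  rcases eq_or_ne h 0 with rfl | hh
  · simp [fwdDiff]
  have hh0 : 0 < ‖h‖ := norm_pos_iff.2 hh
  have hsplit : ∀ y : ℝ, 0 < y → y ^ β = y ^ (β - 1) * y := fun y hy => by
    rw [Real.rpow_sub_one hy.ne', div_mul_cancel₀ _ hy.ne']
  have hρβ : 0 < ρ ^ (β - 1) := Real.rpow_pos_of_pos hρ0 _
  rcases lt_or_ge ρ ‖h‖ with hlt | hle
  · calc |fwdDiff h (P r g) x| ≤ K * ‖h‖ ^ β := hΔ h x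
      _ = K * (‖h‖ ^ (β - 1) * ‖h‖) := by rw [hsplit _ hh0]
      _ ≤ K * (ρ ^ (β - 1) * ‖h‖) := by
          gcongr K * (?_ * _)
          exact Real.rpow_le_rpow_of_nonpos hρ0 hlt.le (by linarith [hβ.2])
      _ = 1 * (ρ ^ (β - 1) * K * ‖h‖) := by ring
      _ ≤ (2 * (1 + c)) * (ρ ^ (β - 1) * K * ‖h‖) := by gcongr; linarith
      _ = _ := by ring
  -- This `N` gives `N • h` a length between `ρ` and `2 * ρ`.
  · set N := ⌈ρ / ‖h‖⌉₊ with hN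
    have hN1 : ρ ≤ N * ‖h‖ := by
      rw [← div_le_iff₀ hh0]
      exact Nat.le_ceil _
    have hN2 : N * ‖h‖ ≤ 2 * ρ := by
      have := (Nat.ceil_lt_add_one (div_pos hρ0 hh0).le).le
      rw [← hN] at this
      calc N * ‖h‖ ≤ (ρ / ‖h‖ + 1) * ‖h‖ := by gcongr
        _ = ρ + ‖h‖ := by field_simp
        _ ≤ 2 * ρ := by linarith
    have hN0 : (0 : ℝ) < N := by
      by_contra hcon
      have : N * ‖h‖ ≤ 0 := mul_nonpos_of_nonpos_of_nonneg (not_lt.1 hcon) hh0.le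
      linarith
    have hpow : (2 * ρ) ^ β ≤ 2 * (ρ ^ (β - 1) * ρ) := by
      rw [Real.mul_rpow (by norm_num) hρ0.le, hsplit ρ hρ0]
      gcongr
      calc (2 : ℝ) ^ β ≤ 2 ^ (1 : ℝ) := Real.rpow_le_rpow_of_exponent_le (by norm_num) hβ.2
        _ = 2 := by norm_num
    have hsmall : ∀ m : ℕ, m ≤ N → ‖(m : ℝ) • h‖ ^ β ≤ 2 * (ρ ^ (β - 1) * ρ) := by
      intro m hm
      refine le_trans (Real.rpow_le_rpow (norm_nonneg _) ?_ hβ.1) hpow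
      rw [norm_smul, Real.norm_natCast]
      refine le_trans ?_ hN2
      gcongr
    have htel := fwdDiff_natCast_smul (P r g) h x N
    -- The difference along `j • h` passes onto `g`, where it is at most of order `K * ρ ^ β`; the
    -- one along `h` then gains `r ^ (-a) * ‖h‖`.
    have hterm : ∀ j ∈ Finset.range N, |fwdDiff ((j : ℝ) • h) (fwdDiff h (P r g)) x| ≤
        c * r ^ (-a) * (K * (2 * (ρ ^ (β - 1) * ρ))) * ‖h‖ := by
      intro j hj
      rw [fwdDiff_comm, ← hP.map_fwdDiff _ hr hg]
      refine (hP.gain hr hrT (hBdd _) h x).trans ?_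
      gcongr
      exact hsmall j (Finset.mem_range.1 hj).le
    have hsum : |∑ j ∈ Finset.range N, fwdDiff ((j : ℝ) • h) (fwdDiff h (P r g)) x| ≤
        N * (c * r ^ (-a) * (K * (2 * (ρ ^ (β - 1) * ρ))) * ‖h‖) := by
      refine (Finset.abs_sum_le_sum_abs _ _).trans ((Finset.sum_le_sum hterm).trans ?_)
      simp
    have hra : r ^ (-a) * ρ = 1 := by
      rw [hρ, ← Real.rpow_add hr]
      simp
    have hfirst : |fwdDiff ((N : ℝ) • h) (P r g) x| ≤
        N * (K * (2 * ρ ^ (β - 1)) * ‖h‖) := by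
      calc _ ≤ K * ‖(N : ℝ) • h‖ ^ β := hΔ _ x
        _ ≤ K * (2 * (ρ ^ (β - 1) * ρ)) := by gcongr; exact hsmall N le_rfl
        _ ≤ K * (2 * (ρ ^ (β - 1) * (N * ‖h‖))) := by gcongr
        _ = _ := by ring
    have hsecond : N * (c * r ^ (-a) * (K * (2 * (ρ ^ (β - 1) * ρ))) * ‖h‖) =
        N * (2 * c * ρ ^ (β - 1) * K * ‖h‖) := by
      calc _ = N * (2 * c * ρ ^ (β - 1) * K * ‖h‖) * (r ^ (-a) * ρ) := by ring
        _ = _ := by rw [hra, mul_one]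
    rw [hsecond] at hsum
    rw [smul_eq_mul] at htel
    have habs : N * |fwdDiff h (P r g) x| ≤
        N * (K * (2 * ρ ^ (β - 1)) * ‖h‖) + N * (2 * c * ρ ^ (β - 1) * K * ‖h‖) := by
      have h3 : (N : ℝ) * fwdDiff h (P r g) x = fwdDiff ((N : ℝ) • h) (P r g) x -
          ∑ j ∈ Finset.range N, fwdDiff ((j : ℝ) • h) (fwdDiff h (P r g)) x := by linarith
      rw [← abs_of_pos hN0, ← abs_mul, h3, abs_of_pos hN0]
      exact (abs_sub _ _).trans (add_le_add hfirst hsum)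
    rw [← mul_add] at habs
    refine (le_of_mul_le_mul_left habs hN0).trans (le_of_eq ?_)
    ring

/-- Smoothing of `β`-Hölder functions by finite differences of order one, two and three. -/
lemma exists_fwdDiff_le_of_holder (hP : IsSmoothingSemigroup P T a c) (hc : 0 < c)
    (hβ : β ∈ Icc (0 : ℝ) 1) :
    ∃ B, 0 < B ∧ ∀ {r K C : ℝ} {g : Euc d → ℝ}, 0 < r → r ≤ T → BddCont C g → 0 ≤ K →
      (∀ h x, |fwdDiff h g x| ≤ K * ‖h‖ ^ β) → ∀ h k l x : Euc d,
        |fwdDiff l (P r g) x| ≤ B * r ^ (-(a * (1 - β))) * K * ‖l‖ ∧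
        |fwdDiff k (fwdDiff l (P r g)) x| ≤ B * r ^ (-(a * (2 - β))) * K * ‖k‖ * ‖l‖ ∧
        |fwdDiff h (fwdDiff k (fwdDiff l (P r g))) x| ≤
          B * r ^ (-(a * (3 - β))) * K * ‖h‖ * ‖k‖ * ‖l‖ := by
  set B₁ := 2 * (1 + c)
  set B₂ := c * B₁ * 2⁻¹ ^ (-(a * (2 - β)))
  set B₃ := c * B₂ * 2⁻¹ ^ (-(a * (3 - β)))
  have hB₁ : 0 < B₁ := by positivity
  have hB₂ : 0 < B₂ := by positivity
  have hB₃ : 0 < B₃ := by positivity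
  -- Each further difference spends half of the remaining time: in `P_r = P_{r/2} P_{r/2}` the outer
  -- factor takes the new difference and the inner one carries the earlier bound. Here powers of `r
  -- / 2` become powers of `r`.
  have key : ∀ (r e : ℝ), 0 < r → ∀ D : ℝ,
      c * (r / 2) ^ (-a) * (D * (r / 2) ^ (-(a * (e - β)))) =
        c * D * 2⁻¹ ^ (-(a * (e + 1 - β))) * r ^ (-(a * (e + 1 - β))) := by
    intro r e hr D
    have h1 : (r / 2) ^ (-a) * (r / 2) ^ (-(a * (e - β))) =
        r ^ (-(a * (e + 1 - β))) * 2⁻¹ ^ (-(a * (e + 1 - β))) := by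
      rw [← Real.rpow_add (by positivity), ← Real.mul_rpow hr.le (by norm_num), div_eq_mul_inv]
      ring_nf
    calc _ = c * D * ((r / 2) ^ (-a) * (r / 2) ^ (-(a * (e - β)))) := by ring
      _ = _ := by rw [h1]; ring
  have h₁ : ∀ {r K C : ℝ} {g : Euc d → ℝ}, 0 < r → r ≤ T → BddCont C g → 0 ≤ K →
      (∀ h x, |fwdDiff h g x| ≤ K * ‖h‖ ^ β) → ∀ l x : Euc d,
        |fwdDiff l (P r g) x| ≤ B₁ * r ^ (-(a * (1 - β))) * K * ‖l‖ :=
    fun hr hrT hg hK hgβ => hP.fwdDiff_le_of_holder hc hβ hr hrT hg hK hgβ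
  have h₂ : ∀ {r K C : ℝ} {g : Euc d → ℝ}, 0 < r → r ≤ T → BddCont C g → 0 ≤ K →
      (∀ h x, |fwdDiff h g x| ≤ K * ‖h‖ ^ β) → ∀ k l x : Euc d,
        |fwdDiff k (fwdDiff l (P r g)) x| ≤ B₂ * r ^ (-(a * (2 - β))) * K * ‖k‖ * ‖l‖ := by
    intro r K C g hr hrT hg hK hgβ k l x
    have hr2 : 0 < r / 2 := half_pos hr
    have hb := hP.bddCont hr2 hg
    conv_lhs => rw [← add_halves r, hP.add hr2 hr2 hg, ← hP.map_fwdDiff l hr2 hb]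
    refine (hP.gain hr2 (by linarith)
      ⟨(hb.fwdDiff l).1, h₁ hr2 (by linarith) hg hK hgβ l⟩ k x).trans (le_of_eq ?_)
    have := key r 1 hr B₁
    rw [show (1 : ℝ) + 1 = 2 by norm_num] at this
    calc _ = c * (r / 2) ^ (-a) * (B₁ * (r / 2) ^ (-(a * (1 - β)))) * K * ‖k‖ * ‖l‖ := by ring
      _ = _ := by rw [this]
  have h₃ : ∀ {r K C : ℝ} {g : Euc d → ℝ}, 0 < r → r ≤ T → BddCont C g → 0 ≤ K →
      (∀ h x, |fwdDiff h g x| ≤ K * ‖h‖ ^ β) → ∀ h k l x : Euc d,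
        |fwdDiff h (fwdDiff k (fwdDiff l (P r g))) x| ≤
          B₃ * r ^ (-(a * (3 - β))) * K * ‖h‖ * ‖k‖ * ‖l‖ := by
    intro r K C g hr hrT hg hK hgβ h k l x
    have hr2 : 0 < r / 2 := half_pos hr
    have hb := hP.bddCont hr2 hg
    conv_lhs => rw [← add_halves r, hP.add hr2 hr2 hg, ← hP.map_fwdDiff l hr2 hb,
      ← hP.map_fwdDiff k hr2 (hb.fwdDiff l)]
    refine (hP.gain hr2 (by linarith)
      ⟨((hb.fwdDiff l).fwdDiff k).1, h₂ hr2 (by linarith) hg hK hgβ k l⟩ h x).trans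
        (le_of_eq ?_)
    have := key r 2 hr B₂
    rw [show (2 : ℝ) + 1 = 3 by norm_num] at this
    calc _ = c * (r / 2) ^ (-a) * (B₂ * (r / 2) ^ (-(a * (2 - β)))) * K * ‖h‖ * ‖k‖ * ‖l‖ := by
          ring
      _ = _ := by rw [this]
  refine ⟨B₁ + B₂ + B₃, by positivity, ?_⟩
  intro r K C g hr hrT hg hK hgβ h k l x
  refine ⟨(h₁ hr hrT hg hK hgβ l x).trans ?_, (h₂ hr hrT hg hK hgβ k l x).trans ?_,
    (h₃ hr hrT hg hK hgβ h k l x).trans ?_⟩ <;> gcongr <;> linarith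

end IsSmoothingSemigroup

/-! ### Interpolation, singular time integrals and absorption. -/

lemma le_rpow_mul_rpow {X p q κ : ℝ} (hκ : κ ∈ Icc (0 : ℝ) 1) (hX : 0 ≤ X) (hp : X ≤ p)
    (hq : X ≤ q) : X ≤ p ^ (1 - κ) * q ^ κ := by
  rcases hX.eq_or_lt with rfl | hX
  · positivity
  · calc X = X ^ (1 - κ) * X ^ κ := by rw [← Real.rpow_add hX]; simp
      _ ≤ p ^ (1 - κ) * q ^ κ := by
        have h1 : 0 ≤ 1 - κ := sub_nonneg.2 hκ.2
        have h2 : 0 ≤ κ := hκ.1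
        have h3 : 0 ≤ p := hX.le.trans hp
        gcongr

/-- The endpoint `s = t`, where `P_{t-s}` has no estimate, is a null set. No integrability of `φ` is
needed, as its integral is `0` by default otherwise. -/
lemma abs_integral_le_of_abs_le_Ioo {t : ℝ} (ht : 0 < t) {φ G : ℝ → ℝ}
    (hG : IntervalIntegrable G volume 0 t) (h : ∀ s ∈ Ioo 0 t, |φ s| ≤ G s) :
    |∫ s in 0..t, φ s| ≤ ∫ s in 0..t, G s := by
  rw [← Real.norm_eq_abs]
  refine intervalIntegral.norm_integral_le_of_norm_le ht.le ?_ hG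
  have hne : ∀ᵐ s : ℝ, s ≠ t := by simp [ae_iff]
  filter_upwards [hne] with s hs hs'
  exact h s ⟨hs'.1, lt_of_le_of_ne hs'.2 hs⟩

lemma intervalIntegrable_rpow_neg {b : ℝ} (hb : b < 1) (t : ℝ) :
    IntervalIntegrable (fun s : ℝ => s ^ (-b)) volume 0 t :=
  intervalIntegral.intervalIntegrable_rpow' (by linarith)

lemma intervalIntegrable_sub_rpow_neg {a : ℝ} (ha : a < 1) (t : ℝ) :
    IntervalIntegrable (fun s : ℝ => (t - s) ^ (-a)) volume 0 t := by
  have := (intervalIntegrable_rpow_neg ha t).comp_sub_left t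
  simpa using this.symm

lemma integral_rpow_neg {b : ℝ} (hb : b < 1) (t : ℝ) :
    ∫ s in 0..t, s ^ (-b) = t ^ (1 - b) / (1 - b) := by
  rw [integral_rpow (Or.inl (by linarith)), Real.zero_rpow (by linarith), neg_add_eq_sub, sub_zero]

lemma integral_sub_rpow_neg {a : ℝ} (ha : a < 1) (t : ℝ) :
    ∫ s in 0..t, (t - s) ^ (-a) = t ^ (1 - a) / (1 - a) := by
  rw [intervalIntegral.integral_comp_sub_left (fun s => s ^ (-a)) t, sub_self, sub_zero,
    integral_rpow_neg ha]

/-- Integrals against the kernel `(t - s) ^ (-a) * s ^ (-b)`. -/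
lemma exists_abs_integral_le_beta {a b : ℝ} (ha : a ∈ Ico (0 : ℝ) 1) (hb : b ∈ Ico (0 : ℝ) 1) :
    ∃ B, 0 < B ∧ ∀ {t K : ℝ} {φ : ℝ → ℝ}, 0 < t → 0 ≤ K →
      (∀ s ∈ Ioo 0 t, |φ s| ≤ K * ((t - s) ^ (-a) * s ^ (-b))) →
      |∫ s in 0..t, φ s| ≤ K * B * t ^ (1 - a - b) := by
  have ha1 : 0 < 1 - a := by linarith [ha.2]
  have hb1 : 0 < 1 - b := by linarith [hb.2]
  refine ⟨2⁻¹ ^ (-a) / (1 - b) + 2⁻¹ ^ (-b) / (1 - a), by positivity, ?_⟩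
  intro t K φ ht hK h
  have hi1 := intervalIntegrable_rpow_neg hb.2 t
  have hi2 := intervalIntegrable_sub_rpow_neg ha.2 t
  have ht2 : 0 < t / 2 := half_pos ht
  -- Each factor is frozen at `t / 2` on the half where it is not singular; the sum of the two
  -- bounds serves on the whole interval.
  refine (abs_integral_le_of_abs_le_Ioo ht
    (G := fun s => K * ((t / 2) ^ (-a) * s ^ (-b) + (t / 2) ^ (-b) * (t - s) ^ (-a)))
    (((hi1.const_mul _).add (hi2.const_mul _)).const_mul K) ?_).trans ?_
  · intro s hs
    refine (h s hs).trans ?_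
    have hs0 := hs.1
    have hts : 0 < t - s := sub_pos.2 hs.2
    gcongr
    rcases le_total s (t / 2) with h1 | h1
    · have h2 : (t - s) ^ (-a) ≤ (t / 2) ^ (-a) :=
        Real.rpow_le_rpow_of_nonpos ht2 (by linarith) (by linarith [ha.1])
      have h3 : (t - s) ^ (-a) * s ^ (-b) ≤ (t / 2) ^ (-a) * s ^ (-b) := by gcongr
      have h4 : 0 ≤ (t / 2) ^ (-b) * (t - s) ^ (-a) := by positivity
      linarith
    · have h2 : s ^ (-b) ≤ (t / 2) ^ (-b) :=
        Real.rpow_le_rpow_of_nonpos ht2 h1 (by linarith [hb.1])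
      have h3 : (t - s) ^ (-a) * s ^ (-b) ≤ (t - s) ^ (-a) * (t / 2) ^ (-b) := by gcongr
      have h4 : 0 ≤ (t / 2) ^ (-a) * s ^ (-b) := by positivity
      linarith
  · rw [intervalIntegral.integral_const_mul, intervalIntegral.integral_add (hi1.const_mul _)
      (hi2.const_mul _), intervalIntegral.integral_const_mul, intervalIntegral.integral_const_mul,
      integral_rpow_neg hb.2, integral_sub_rpow_neg ha.2, div_eq_mul_inv t 2,
      Real.mul_rpow ht.le (by norm_num), Real.mul_rpow ht.le (by norm_num)]
    have e1 : t ^ (1 - a - b) = t ^ (-a) * t ^ (1 - b) := by rw [← Real.rpow_add ht]; ring_nf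
    have e2 : t ^ (1 - a - b) = t ^ (-b) * t ^ (1 - a) := by rw [← Real.rpow_add ht]; ring_nf
    rw [mul_assoc K, add_mul]
    nth_rw 1 [e1]
    rw [e2]
    refine le_of_eq ?_
    ring

/-- An exponential weight makes the kernel `(t - s) ^ (-a) * s ^ (-b)` small. -/
lemma exists_abs_integral_le_exp {a b T : ℝ} (ha : a ∈ Ico (0 : ℝ) 1) (hb : b ∈ Ico (0 : ℝ) 1)
    (hT : 0 < T) :
    ∃ B ε : ℝ, 0 < B ∧ 0 < ε ∧ ∀ {t K l : ℝ} {φ : ℝ → ℝ}, 0 < t → t ≤ T → 0 ≤ K → 0 < l →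
      (∀ s ∈ Ioo 0 t, |φ s| ≤ K * ((t - s) ^ (-a) * (Real.exp (l * s) * s ^ (-b)))) →
      |∫ s in 0..t, φ s| ≤ K * (B * l ^ (-ε)) * (Real.exp (l * t) * t ^ (-b)) := by
  -- Half of the margin `1 - a` is spent: the kernel with exponent `a + ε` is still integrable.
  set ε := (1 - a) / 2 with hε
  have hε0 : 0 < ε := by rw [hε]; linarith [ha.2]
  have hε1 : ε ≤ 1 := by rw [hε]; linarith [ha.1]
  obtain ⟨B, hB, hint⟩ := exists_abs_integral_le_beta (a := a + ε) (b := b)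
    ⟨by linarith [ha.1], by rw [hε]; linarith [ha.2]⟩ hb
  refine ⟨B * T ^ (1 - (a + ε)), ε, by positivity, hε0, ?_⟩
  intro t K l φ ht htT hK hl h
  refine (hint (K := K * (l ^ (-ε) * Real.exp (l * t))) ht (by positivity) ?_).trans ?_
  · intro s hs
    refine (h s hs).trans ?_
    have hs0 := hs.1
    have hts : 0 < t - s := sub_pos.2 hs.2
    -- For `ε ≤ 1` and `y ≥ 0`, `y ^ ε ≤ 1 + y ≤ exp y`, with `y = l * (t - s)`. The price `(t - s)
    -- ^ (-ε)` buys the small factor `l ^ (-ε)`.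
    have hle : Real.exp (l * s) ≤ Real.exp (l * t) * (l ^ (-ε) * (t - s) ^ (-ε)) := by
      rw [← Real.mul_rpow hl.le hts.le, Real.rpow_neg (by positivity), ← div_eq_mul_inv,
        le_div_iff₀ (by positivity)]
      have h1 : (l * (t - s)) ^ ε ≤ Real.exp (l * (t - s)) := by
        calc (l * (t - s)) ^ ε ≤ (1 + l * (t - s)) ^ ε := by
              gcongr; linarith
          _ ≤ (1 + l * (t - s)) ^ (1 : ℝ) :=
              Real.rpow_le_rpow_of_exponent_le (by nlinarith [mul_pos hl hts]) hε1
          _ = l * (t - s) + 1 := by rw [Real.rpow_one, add_comm]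
          _ ≤ _ := Real.add_one_le_exp _
      calc Real.exp (l * s) * (l * (t - s)) ^ ε ≤ Real.exp (l * s) * Real.exp (l * (t - s)) := by
            gcongr
        _ = Real.exp (l * t) := by rw [← Real.exp_add]; ring_nf
    calc K * ((t - s) ^ (-a) * (Real.exp (l * s) * s ^ (-b)))
        ≤ K * ((t - s) ^ (-a) * (Real.exp (l * t) * (l ^ (-ε) * (t - s) ^ (-ε)) * s ^ (-b))) := by
          gcongr
      _ = K * (l ^ (-ε) * Real.exp (l * t)) * (((t - s) ^ (-a) * (t - s) ^ (-ε)) * s ^ (-b)) := by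
          ring
      _ = _ := by rw [← Real.rpow_add hts, ← neg_add]
  · have h1 : t ^ (1 - (a + ε) - b) ≤ T ^ (1 - (a + ε)) * t ^ (-b) := by
      rw [sub_eq_add_neg _ b, Real.rpow_add ht]
      gcongr
      rw [hε]
      linarith [ha.2]
    calc _ ≤ K * (l ^ (-ε) * Real.exp (l * t)) * B * (T ^ (1 - (a + ε)) * t ^ (-b)) := by gcongr
      _ = _ := by ring

/-- Absorption: a bounded family whose weighted bound `W` improves to `A + W / 2` is bounded
by `2 * A`. -/
lemma le_two_mul_of_improve {X : Type*} {w : ℝ → X → ℝ} {T A W₀ : ℝ} {ω : ℝ → ℝ}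
    (hω : ∀ s ∈ Ioc 0 T, 0 ≤ ω s) (hW₀ : 0 ≤ W₀) (hA : 0 ≤ A) (hw : ∀ s ∈ Ioc 0 T, ∀ y, w s y ≤ W₀ * ω s)
    (himp : ∀ W, 0 ≤ W → (∀ s ∈ Ioc 0 T, ∀ y, w s y ≤ W * ω s) →
      ∀ s ∈ Ioc 0 T, ∀ y, w s y ≤ (A + W / 2) * ω s) :
    ∀ s ∈ Ioc 0 T, ∀ y, w s y ≤ 2 * A * ω s := by
  -- The map `W ↦ A + W / 2` has fixed point `2 * A`; iterating it from `2 * A + W₀` halves the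
  -- excess each time.
  have hn : ∀ n : ℕ, ∀ s ∈ Ioc 0 T, ∀ y, w s y ≤ (2 * A + W₀ * 2⁻¹ ^ n) * ω s := by
    intro n
    induction n with
    | zero =>
      intro s hs y
      rw [pow_zero, mul_one, add_mul]
      have h1 := hω s hs
      have h2 : 0 ≤ 2 * A * ω s := by positivity
      linarith [hw s hs y]
    | succ n ih =>
      intro s hs y
      refine (himp _ (by positivity) ih s hs y).trans (le_of_eq ?_)
      ring
  intro s hs y
  have hlim : Tendsto (fun n : ℕ => (2 * A + W₀ * (2⁻¹ : ℝ) ^ n) * ω s) atTop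
      (𝓝 ((2 * A + W₀ * 0) * ω s)) :=
    ((tendsto_const_nhds.mul (tendsto_pow_atTop_nhds_zero_of_lt_one (by norm_num)
      (by norm_num))).const_add _).mul_const _
  simpa using ge_of_tendsto' hlim fun n => hn n s hs y

/-- Integrals against the kernel `s ^ (-b) * min ((t - s) ^ (-a)) (η * (t - s) ^ (-(a + e)))`. -/
lemma exists_abs_integral_le_min {a b e : ℝ} (ha : a ∈ Ico (0 : ℝ) 1) (hb : b ∈ Ico (0 : ℝ) 1)
    (hae : 1 < a + e) :
    ∃ B, 0 < B ∧ ∀ {t K η : ℝ} {φ : ℝ → ℝ}, 0 < t → 0 ≤ K → 0 < η →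
      (∀ s ∈ Ioo 0 t, |φ s| ≤ K * (s ^ (-b) * (t - s) ^ (-a)) ∧
        |φ s| ≤ K * (s ^ (-b) * (η * (t - s) ^ (-(a + e))))) →
      |∫ s in 0..t, φ s| ≤ K * B * η ^ ((1 - a) / e) * t ^ (-b) := by
  have ha1 : 0 < 1 - a := by linarith [ha.2]
  have hb1 : 0 < 1 - b := by linarith [hb.2]
  have he : 0 < e := by linarith [ha.2]
  have hae1 : 0 < a + e - 1 := by linarith
  -- The exponent for which the interpolated kernel has power `a + e * κ = 1`.
  set κ := (1 - a) / e with hκ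
  have hκ01 : κ ∈ Icc (0 : ℝ) 1 := ⟨by positivity, by rw [hκ, div_le_one he]; linarith⟩
  refine ⟨2 / (1 - b) + 2⁻¹ ^ (-b) * (1 / (1 - a) + 1 / (a + e - 1)), by positivity, ?_⟩
  intro t K η φ ht hK hη h
  have ht2 : 0 < t / 2 := half_pos ht
  -- At `r = ρ` the bounds `r ^ (-a)` and `η * r ^ (-(a + e))` agree. The first is integrable at
  -- `0`, the second at infinity, and both pieces scale like `η ^ κ`.
  set ρ := η ^ (1 / e) with hρ
  have hρ0 : 0 < ρ := Real.rpow_pos_of_pos hη _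
  set m₁ : ℝ → ℝ := (Ioc 0 ρ).indicator fun r => r ^ (-a) with hm₁
  set m₂ : ℝ → ℝ := (Ioi ρ).indicator fun r => η * r ^ (-(a + e)) with hm₂
  have hi₁ : Integrable m₁ := by
    rw [hm₁, integrable_indicator_iff measurableSet_Ioc]
    exact (intervalIntegrable_iff_integrableOn_Ioc_of_le hρ0.le).1
      (intervalIntegrable_rpow_neg ha.2 ρ)
  have hi₂ : Integrable m₂ := by
    rw [hm₂, integrable_indicator_iff measurableSet_Ioi]
    exact (integrableOn_Ioi_rpow_of_lt (by linarith) hρ0).const_mul η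
  have hm_nonneg : ∀ r, 0 ≤ m₁ r + m₂ r := fun r => add_nonneg
    (indicator_nonneg (fun r hr => Real.rpow_nonneg hr.1.le _) r)
    (indicator_nonneg (fun r hr => mul_nonneg hη.le
      (Real.rpow_nonneg (hρ0.trans hr).le _)) r)
  have hm_int : ∫ s in 0..t, (m₁ (t - s) + m₂ (t - s)) ≤
      η ^ κ * (1 / (1 - a) + 1 / (a + e - 1)) := by
    rw [intervalIntegral.integral_comp_sub_left (fun r => m₁ r + m₂ r) t, sub_self, sub_zero,
      intervalIntegral.integral_of_le ht.le]
    refine (setIntegral_le_integral (hi₁.add hi₂) (Eventually.of_forall hm_nonneg)).trans ?_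
    refine (integral_add hi₁ hi₂).trans_le ?_
    rw [hm₁, hm₂, integral_indicator measurableSet_Ioc, integral_indicator measurableSet_Ioi,
      ← intervalIntegral.integral_of_le hρ0.le, integral_rpow_neg ha.2, integral_const_mul,
      integral_Ioi_rpow_of_lt (by linarith) hρ0]
    have e1 : ρ ^ (1 - a) = η ^ κ := by
      rw [hρ, ← Real.rpow_mul hη.le, hκ]; ring_nf
    have e2 : η * ρ ^ (-(a + e) + 1) = η ^ κ := by
      rw [hρ, ← Real.rpow_mul hη.le]
      nth_rw 1 [← Real.rpow_one η]
      rw [← Real.rpow_add hη, hκ]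
      congr 1
      field_simp
      ring
    have e3 : -(a + e) + 1 = -(a + e - 1) := by ring
    rw [e1, neg_div, mul_neg, mul_div_assoc', e2, e3, div_neg, neg_neg]
    refine le_of_eq ?_
    ring
  have hi3 := intervalIntegrable_rpow_neg hb.2 t
  have hi4 : IntervalIntegrable (fun s => m₁ (t - s) + m₂ (t - s)) volume 0 t :=
    ((hi₁.add hi₂).comp_sub_left t).intervalIntegrable
  refine (abs_integral_le_of_abs_le_Ioo ht
    (G := fun s => K * (η ^ κ * (2 / t) * s ^ (-b) +
      (t / 2) ^ (-b) * (m₁ (t - s) + m₂ (t - s))))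
    (((hi3.const_mul _).add (hi4.const_mul _)).const_mul K) ?_).trans ?_
  · intro s hs
    have hs0 := hs.1
    have hts : 0 < t - s := sub_pos.2 hs.2
    obtain ⟨h1, h2⟩ := h s hs
    have hnn := hm_nonneg (t - s)
    have hsb : 0 < s ^ (-b) := Real.rpow_pos_of_pos hs0 _
    rcases le_total s (t / 2) with hst | hst
    -- Away from `s = t` the geometric mean of the two bounds already has the factor `η ^ κ`, and
    -- `(t - s)⁻¹ ≤ 2 / t`.
    · have h3 : |φ s| ≤ K * s ^ (-b) * (η ^ κ * (t - s)⁻¹) := by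
        rcases hK.eq_or_lt with rfl | hK
        · simpa using h1
        have h4 := le_rpow_mul_rpow hκ01 (X := |φ s| / (K * s ^ (-b))) (by positivity)
          (p := (t - s) ^ (-a)) (q := η * (t - s) ^ (-(a + e)))
          (by rw [div_le_iff₀ (by positivity)]; linarith)
          (by rw [div_le_iff₀ (by positivity)]; linarith)
        rw [div_le_iff₀ (by positivity), Real.mul_rpow hη.le (by positivity),
          ← Real.rpow_mul hts.le, ← Real.rpow_mul hts.le] at h4
        refine h4.trans (le_of_eq ?_)
        have e1 : (t - s)⁻¹ = (t - s) ^ (-a * (1 - κ)) * (t - s) ^ (-(a + e) * κ) := by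
          rw [← Real.rpow_add hts, ← Real.rpow_neg_one, hκ]
          congr 1
          field_simp
          ring
        rw [e1]
        ring
      have h5 : (t - s)⁻¹ ≤ 2 / t := by
        rw [← inv_div]
        exact inv_anti₀ ht2 (by linarith)
      calc |φ s| ≤ K * s ^ (-b) * (η ^ κ * (t - s)⁻¹) := h3
        _ ≤ K * s ^ (-b) * (η ^ κ * (2 / t)) := by gcongr
        _ = K * (η ^ κ * (2 / t) * s ^ (-b) + 0) := by ring
        _ ≤ _ := by gcongr; positivity
    · have hsb2 : s ^ (-b) ≤ (t / 2) ^ (-b) :=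
        Real.rpow_le_rpow_of_nonpos ht2 hst (by linarith [hb.1])
      have h3 : |φ s| ≤ K * (s ^ (-b) * (m₁ (t - s) + m₂ (t - s))) := by
        rcases le_or_gt (t - s) ρ with hr | hr
        · have h4 : m₁ (t - s) = (t - s) ^ (-a) := indicator_of_mem (mem_Ioc.2 ⟨hts, hr⟩) _
          have h5 : m₂ (t - s) = 0 := indicator_of_notMem (fun h => not_lt.2 hr h) _
          rwa [h4, h5, add_zero]
        · have h4 : m₁ (t - s) = 0 := indicator_of_notMem (fun h => not_le.2 hr h.2) _
          have h5 : m₂ (t - s) = η * (t - s) ^ (-(a + e)) := indicator_of_mem hr _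
          rwa [h4, h5, zero_add]
      calc |φ s| ≤ K * (s ^ (-b) * (m₁ (t - s) + m₂ (t - s))) := h3
        _ ≤ K * (0 + (t / 2) ^ (-b) * (m₁ (t - s) + m₂ (t - s))) := by
            rw [zero_add]; gcongr
        _ ≤ _ := by gcongr; positivity
  · rw [intervalIntegral.integral_const_mul, intervalIntegral.integral_add (hi3.const_mul _)
      (hi4.const_mul _), intervalIntegral.integral_const_mul, intervalIntegral.integral_const_mul,
      integral_rpow_neg hb.2]
    have e1 : t ^ (1 - b) = t * t ^ (-b) := by
      rw [sub_eq_add_neg, Real.rpow_add ht, Real.rpow_one]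
    have e2 : (t / 2) ^ (-b) = t ^ (-b) * 2⁻¹ ^ (-b) := by
      rw [div_eq_mul_inv, Real.mul_rpow ht.le (by norm_num)]
    calc _ ≤ K * (η ^ κ * (2 / t) * (t ^ (1 - b) / (1 - b)) +
          (t / 2) ^ (-b) * (η ^ κ * (1 / (1 - a) + 1 / (a + e - 1)))) := by gcongr
      _ = _ := by
        rw [e1, e2]
        field_simp

/-! ### From finite differences to derivatives and Hölder seminorms. -/

lemma continuous_of_norm_fwdDiff_le {E F : Type*} [NormedAddCommGroup E] [NormedAddCommGroup F]
    {f : E → F} {C κ : ℝ} (hκ : 0 < κ)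
    (h : ∀ k x, ‖fwdDiff k f x‖ ≤ C * ‖k‖ ^ κ) : Continuous f := by
  rw [continuous_iff_continuousAt]
  intro x
  rw [ContinuousAt, tendsto_iff_norm_sub_tendsto_zero]
  refine squeeze_zero (fun _ => norm_nonneg _)
    (g := fun y => C * ‖y - x‖ ^ κ) (fun y => ?_) ?_
  · simpa [fwdDiff] using h (y - x) x
  · have h1 : Continuous fun y : E => C * ‖y - x‖ ^ κ :=
      continuous_const.mul ((by fun_prop : Continuous fun y : E => ‖y - x‖).rpow_const
        fun _ => Or.inr hκ.le)
    simpa [Real.zero_rpow hκ.ne'] using h1.tendsto x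

section Calculus

variable {E F : Type*} [NormedAddCommGroup E] [NormedSpace ℝ E] [NormedAddCommGroup F]
  [NormedSpace ℝ F]

lemma differentiable_fwdDiff {v : E → F} (hv : Differentiable ℝ v) (h : E) :
    Differentiable ℝ (fwdDiff h v) :=
  (hv.comp (differentiable_id.add_const h)).sub hv

lemma fderiv_fwdDiff {v : E → F} (hv : Differentiable ℝ v) (h : E) :
    fderiv ℝ (fwdDiff h v) = fwdDiff h (fderiv ℝ v) := by
  ext1 x
  have h1 : DifferentiableAt ℝ (fun y => v (y + h)) x :=
    (hv.comp (differentiable_id.add_const h)) x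
  change fderiv ℝ (fun y => v (y + h) - v y) x = _
  rw [fderiv_fun_sub h1 (hv x), fderiv_comp_add_right, fwdDiff]

lemma norm_fderiv_le_of_norm_fwdDiff_le {v : E → F} {x : E} {B : ℝ} (hB : 0 ≤ B)
    (h : ∀ k, ‖fwdDiff k v x‖ ≤ B * ‖k‖) : ‖fderiv ℝ v x‖ ≤ B := by
  refine norm_fderiv_le_of_lip' ℝ hB (Eventually.of_forall fun y => ?_)
  simpa [fwdDiff] using h (y - x)

/-- Cut `k` into `n` equal steps. In the telescoping identity `n` times the first step tends to the
derivative, and the `n` second differences are each at most `C * ‖k‖ ^ κ * ‖k‖ / n`. The bound does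
not depend on the point. -/
lemma norm_fwdDiff_sub_fderiv_le {v : E → F} {C κ : ℝ} (hC : 0 ≤ C) (hκ : 0 ≤ κ)
    (hv : ∀ h k x, ‖fwdDiff h (fwdDiff k v) x‖ ≤ C * ‖h‖ ^ κ * ‖k‖) {y : E}
    (hy : DifferentiableAt ℝ v y) (k : E) :
    ‖fwdDiff k v y - fderiv ℝ v y k‖ ≤ C * ‖k‖ ^ κ * ‖k‖ := by
  have hlim : Tendsto (fun n : ℕ => (n : ℝ) • fwdDiff ((n : ℝ)⁻¹ • k) v y) atTop
      (𝓝 (fderiv ℝ v y k)) := by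
    refine hy.hasFDerivAt.lim k (c := fun n : ℕ => (n : ℝ)) ?_
    simpa using tendsto_natCast_atTop_atTop (R := ℝ)
  refine le_of_tendsto (tendsto_const_nhds.sub hlim).norm ?_
  filter_upwards [eventually_gt_atTop 0] with n hn
  have hn0 : (0 : ℝ) < n := by exact_mod_cast hn
  have h1 := fwdDiff_natCast_smul v ((n : ℝ)⁻¹ • k) y n
  rw [smul_inv_smul₀ hn0.ne'] at h1
  rw [h1, add_sub_cancel_left]
  refine (norm_sum_le _ _).trans ?_
  have h2 : ∀ j ∈ Finset.range n,
      ‖fwdDiff ((j : ℝ) • (n : ℝ)⁻¹ • k) (fwdDiff ((n : ℝ)⁻¹ • k) v) y‖ ≤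
        C * ‖k‖ ^ κ * ((n : ℝ)⁻¹ * ‖k‖) := by
    intro j hj
    have hjn : (j : ℝ) ≤ n := by exact_mod_cast (Finset.mem_range.1 hj).le
    refine (hv _ _ _).trans ?_
    have h3 : (j : ℝ) * ((n : ℝ)⁻¹ * ‖k‖) ≤ ‖k‖ := by
      rw [← mul_assoc, ← div_eq_mul_inv]
      exact mul_le_of_le_one_left (norm_nonneg _) ((div_le_one hn0).2 hjn)
    rw [norm_smul, norm_smul, norm_inv, Real.norm_natCast, Real.norm_natCast]
    gcongr
  refine (Finset.sum_le_sum h2).trans (le_of_eq ?_)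
  rw [Finset.sum_const, Finset.card_range, nsmul_eq_mul]
  field_simp

variable [FiniteDimensional ℝ E] [FiniteDimensional ℝ F]

/-- A Lipschitz function whose second differences satisfy a `(1 + κ)`-bound is differentiable. -/
lemma differentiable_of_norm_fwdDiff_fwdDiff_le {v : E → F} {C K κ : ℝ} (hC : 0 ≤ C)
    (hK : 0 ≤ K) (hκ : 0 < κ) (hlip : ∀ k x, ‖fwdDiff k v x‖ ≤ K * ‖k‖)
    (hv : ∀ h k x, ‖fwdDiff h (fwdDiff k v) x‖ ≤ C * ‖h‖ ^ κ * ‖k‖) : Differentiable ℝ v := by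
  borelize E
  have hL : LipschitzWith K.toNNReal v := by
    refine LipschitzWith.of_dist_le_mul fun x y => ?_
    rw [dist_eq_norm, dist_eq_norm, Real.coe_toNNReal K hK]
    simpa [fwdDiff] using hlip (x - y) y
  -- Rademacher's theorem. The differentials at nearby good points lie in a compact ball, and the
  -- uniform remainder estimate passes to a limit `L`, which is then the differential at `x`.
  have hdense : Dense {x | DifferentiableAt ℝ v x} :=
    Measure.dense_of_ae (hL.ae_differentiableAt (μ := Measure.addHaar))
  intro x
  obtain ⟨y, hy, hyx⟩ := mem_closure_iff_seq_limit.1 (hdense x)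
  have : ProperSpace (E →L[ℝ] F) := FiniteDimensional.proper ℝ _
  obtain ⟨L, -, φ, hφ, hlim⟩ := (isCompact_closedBall (0 : E →L[ℝ] F) K).tendsto_subseq
    (x := fun n => fderiv ℝ v (y n)) fun n => by
      rw [mem_closedBall_zero_iff]
      exact norm_fderiv_le_of_norm_fwdDiff_le hK fun k => hlip k (y n)
  have hyx' := hyx.comp hφ.tendsto_atTop
  have hbound : ∀ k, ‖v (x + k) - v x - L k‖ ≤ C * ‖k‖ ^ κ * ‖k‖ := by
    intro k
    have h1 : Tendsto (fun n => v (y (φ n) + k) - v (y (φ n)) - fderiv ℝ v (y (φ n)) k) atTop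
        (𝓝 (v (x + k) - v x - L k)) :=
      (((hL.continuous.tendsto _).comp (hyx'.add_const k)).sub
        ((hL.continuous.tendsto _).comp hyx')).sub
        (((ContinuousLinearMap.apply ℝ F k).continuous.tendsto L).comp hlim)
    exact le_of_tendsto' h1.norm fun n =>
      norm_fwdDiff_sub_fderiv_le hC hκ.le hv (hy (φ n)) k
  refine HasFDerivAt.differentiableAt (f' := L) ?_
  rw [hasFDerivAt_iff_isLittleO_nhds_zero, Asymptotics.isLittleO_iff]
  intro ε hε
  have h0 : Tendsto (fun k : E => C * ‖k‖ ^ κ) (𝓝 0) (𝓝 0) := by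
    have h1 : Continuous fun k : E => C * ‖k‖ ^ κ :=
      continuous_const.mul (continuous_norm.rpow_const fun _ => Or.inr hκ.le)
    simpa [Real.zero_rpow hκ.ne'] using h1.tendsto 0
  filter_upwards [h0.eventually_le_const hε] with k hk
  exact (hbound k).trans (by gcongr)

end Calculus

section Holder

variable {d : ℕ}

lemma holderSeminorm_le {F : Type*} [NormedAddCommGroup F] {κ C : ℝ} {f : Euc d → F}
    (h : ∀ k x, ‖fwdDiff k f x‖ ≤ C * ‖k‖ ^ κ) : holderSeminorm κ f ≤ ENNReal.ofReal C := by
  refine iSup_le fun x => iSup_le fun k => iSup_le fun hk => ?_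
  have h0 : 0 < ‖k‖ ^ κ := Real.rpow_pos_of_pos (norm_pos_iff.2 hk) κ
  rw [ENNReal.div_le_iff (by simpa using h0) ENNReal.ofReal_ne_top,
    ← ENNReal.ofReal_mul' h0.le, ← ofReal_norm]
  exact ENNReal.ofReal_le_ofReal (h k x)

lemma supNorm_le {F : Type*} [NormedAddCommGroup F] {C : ℝ} {f : Euc d → F}
    (h : ∀ x, ‖f x‖ ≤ C) : supNorm f ≤ ENNReal.ofReal C := by
  refine iSup_le fun x => ?_
  rw [← ofReal_norm]
  exact ENNReal.ofReal_le_ofReal (h x)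

lemma norm_fwdDiff_iteratedFDeriv_succ {F : Type*} [NormedAddCommGroup F] [NormedSpace ℝ F]
    (f : Euc d → F) (n : ℕ) (k x : Euc d) :
    ‖fwdDiff k (iteratedFDeriv ℝ (n + 1) f) x‖ =
      ‖fwdDiff k (iteratedFDeriv ℝ n (fderiv ℝ f)) x‖ := by
  simp only [fwdDiff, iteratedFDeriv_succ_eq_comp_right, Function.comp_apply]
  rw [← dist_eq_norm, ← dist_eq_norm, LinearIsometryEquiv.dist_map]

lemma norm_fwdDiff_iteratedFDeriv_zero {F : Type*} [NormedAddCommGroup F] [NormedSpace ℝ F]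
    (f : Euc d → F) (k x : Euc d) :
    ‖fwdDiff k (iteratedFDeriv ℝ 0 f) x‖ = ‖fwdDiff k f x‖ := by
  simp only [fwdDiff, iteratedFDeriv_zero_eq_comp, Function.comp_apply]
  rw [← dist_eq_norm, ← dist_eq_norm, LinearIsometryEquiv.dist_map]

lemma norm_fwdDiff_fderiv_le {F : Type*} [NormedAddCommGroup F] [NormedSpace ℝ F] {f : Euc d → F}
    (hf : Differentiable ℝ f) {B : ℝ} {k x : Euc d} (hB : 0 ≤ B)
    (h : ∀ l, ‖fwdDiff l (fwdDiff k f) x‖ ≤ B * ‖l‖) : ‖fwdDiff k (fderiv ℝ f) x‖ ≤ B := by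
  rw [← fderiv_fwdDiff hf]
  exact norm_fderiv_le_of_norm_fwdDiff_le hB h

lemma holderSeminorm_iteratedFDeriv_one_le {f : Euc d → ℝ} (hf : Differentiable ℝ f) {C κ : ℝ}
    (hC : 0 ≤ C) (h : ∀ k l x, |fwdDiff k (fwdDiff l f) x| ≤ C * ‖k‖ ^ κ * ‖l‖) :
    holderSeminorm κ (iteratedFDeriv ℝ 1 f) ≤ ENNReal.ofReal C := by
  refine holderSeminorm_le fun k x => ?_
  rw [norm_fwdDiff_iteratedFDeriv_succ, norm_fwdDiff_iteratedFDeriv_zero]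
  refine norm_fwdDiff_fderiv_le hf (by positivity) fun l => ?_
  rw [fwdDiff_comm]
  exact h k l x

/-- Applied to `fderiv ℝ f`: second differences of `f` make it Lipschitz, third differences make it
differentiable and its derivative `κ`-Hölder. -/
lemma regularity_of_fwdDiff_le {f : Euc d → ℝ} (hf : Differentiable ℝ f)
    {C K κ : ℝ} (hC : 0 ≤ C) (hK : 0 ≤ K) (hκ : 0 < κ)
    (h₂ : ∀ k l x, |fwdDiff k (fwdDiff l f) x| ≤ K * ‖k‖ * ‖l‖)
    (h₃ : ∀ h k l x, |fwdDiff h (fwdDiff k (fwdDiff l f)) x| ≤ C * ‖h‖ ^ κ * ‖k‖ * ‖l‖) :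
    ContDiff ℝ 2 f ∧ supNorm (iteratedFDeriv ℝ 2 f) ≤ ENNReal.ofReal K ∧
      holderSeminorm κ (iteratedFDeriv ℝ 2 f) ≤ ENNReal.ofReal C := by
  have hlip : ∀ k x, ‖fwdDiff k (fderiv ℝ f) x‖ ≤ K * ‖k‖ := fun k x =>
    norm_fwdDiff_fderiv_le hf (by positivity) fun l => by
      rw [fwdDiff_comm]; exact h₂ k l x
  have hhol : ∀ h k x, ‖fwdDiff h (fwdDiff k (fderiv ℝ f)) x‖ ≤ C * ‖h‖ ^ κ * ‖k‖ := by
    intro h k x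
    rw [← fderiv_fwdDiff hf]
    refine norm_fwdDiff_fderiv_le (differentiable_fwdDiff hf k) (by positivity) fun l => ?_
    rw [fwdDiff_comm, fwdDiff_comm l k]
    exact h₃ h k l x
  have hdiff := differentiable_of_norm_fwdDiff_fwdDiff_le hC hK hκ hlip hhol
  have hD2 : ∀ k x, ‖fwdDiff k (fderiv ℝ (fderiv ℝ f)) x‖ ≤ C * ‖k‖ ^ κ := fun k x =>
    norm_fwdDiff_fderiv_le hdiff (by positivity) fun l => by
      rw [fwdDiff_comm]; exact hhol k l x
  refine ⟨?_, ?_, ?_⟩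
  · have hcont : Continuous (fderiv ℝ (fderiv ℝ f)) :=
      continuous_of_norm_fwdDiff_le (E := Euc d) (F := Euc d →L[ℝ] Euc d →L[ℝ] ℝ) hκ hD2
    have h1 : ContDiff ℝ 1 (fderiv ℝ f) := contDiff_one_iff_fderiv.2 ⟨hdiff, hcont⟩
    have h2 : ContDiff ℝ (1 + 1) f :=
      contDiff_succ_iff_fderiv.2 ⟨hf, fun h => by simp at h, h1⟩
    simpa [one_add_one_eq_two] using h2
  · refine supNorm_le fun x => ?_
    rw [← norm_iteratedFDeriv_fderiv, norm_iteratedFDeriv_one]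
    exact norm_fderiv_le_of_norm_fwdDiff_le hK fun k => hlip k x
  · refine holderSeminorm_le fun k x => ?_
    rw [norm_fwdDiff_iteratedFDeriv_succ, norm_fwdDiff_iteratedFDeriv_succ,
      norm_fwdDiff_iteratedFDeriv_zero]
    exact hD2 k x

end Holder

/-! ### Schauder estimates for the Duhamel formula. -/

section Duhamel

variable {d : ℕ}

lemma le_mul_rpow_of_le {X D y κ : ℝ} (hκ : κ ∈ Icc (0 : ℝ) 1) (hX : 0 ≤ X) (hy : 0 ≤ y)
    (h0 : X ≤ D) (h1 : X ≤ D * y) : X ≤ D * y ^ κ := by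
  have hD : 0 ≤ D := hX.trans h0
  refine (le_rpow_mul_rpow hκ hX h0 h1).trans (le_of_eq ?_)
  rw [Real.mul_rpow hD hy, ← mul_assoc, ← Real.rpow_add_of_nonneg hD (sub_nonneg.2 hκ.2) hκ.1]
  simp

lemma abs_fwdDiff_le_two_mul {v : Euc d → ℝ} {B : ℝ} (hv : ∀ x, |v x| ≤ B) (h x : Euc d) :
    |fwdDiff h v x| ≤ 2 * B := by
  have h1 : |v (x + h) - v x| ≤ |v (x + h)| + |v x| := abs_sub _ _
  have h2 := hv (x + h)
  have h3 := hv x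
  rw [fwdDiff]
  linarith

/-- Lets a milder singularity at `t = 0` be absorbed into a stronger one on `(0, T]`. -/
lemma rpow_neg_le_mul_rpow_neg {t T p q : ℝ} (ht : 0 < t) (htT : t ≤ T) (hpq : p ≤ q) :
    t ^ (-p) ≤ T ^ (q - p) * t ^ (-q) := by
  calc t ^ (-p) = t ^ (q - p) * t ^ (-q) := by rw [← Real.rpow_add ht]; ring_nf
    _ ≤ _ := by gcongr

/-- The formula `v = g + ∫₀ᵗ F(s) ds`, pointwise. -/
structure DuhamelAt (t : ℝ) (v g : Euc d → ℝ) (F : ℝ → Euc d → ℝ) : Prop where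
  integrable : ∀ x, IntervalIntegrable (fun s => F s x) volume 0 t
  eq : ∀ x, v x = g x + ∫ s in (0 : ℝ)..t, F s x

lemma DuhamelAt.fwdDiff {t : ℝ} {v g : Euc d → ℝ} {F : ℝ → Euc d → ℝ} (h : DuhamelAt t v g F)
    (k : Euc d) : DuhamelAt t (fwdDiff k v) (fwdDiff k g) fun s => fwdDiff k (F s) := by
  refine ⟨fun x => (h.integrable (x + k)).sub (h.integrable x), fun x => ?_⟩
  simp only [_root_.fwdDiff]
  rw [h.eq, h.eq, intervalIntegral.integral_sub (h.integrable _) (h.integrable _)]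
  ring

lemma DuhamelAt.abs_le {t : ℝ} {v g : Euc d → ℝ} {F : ℝ → Euc d → ℝ} (h : DuhamelAt t v g F)
    {x : Euc d} {B₁ B₂ : ℝ} (h₁ : |g x| ≤ B₁) (h₂ : |∫ s in (0 : ℝ)..t, F s x| ≤ B₂) :
    |v x| ≤ B₁ + B₂ := by
  rw [h.eq]
  exact (abs_add_le _ _).trans (add_le_add h₁ h₂)

namespace IsSmoothingSemigroup

variable {P : ℝ → (Euc d → ℝ) → Euc d → ℝ} {T a c β : ℝ}

/-- Smoothing of Lipschitz functions. -/
lemma exists_fwdDiff_le_of_lipschitz (hP : IsSmoothingSemigroup P T a c) (hc : 0 < c)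
    {C K : ℝ} {g : Euc d → ℝ} (hg : BddCont C g) (hK : 0 ≤ K)
    (hlip : ∀ h x, |fwdDiff h g x| ≤ K * ‖h‖) :
    ∃ B, 0 ≤ B ∧ ∀ t ∈ Ioc 0 T, ∀ h k l x : Euc d,
      |fwdDiff k (fwdDiff l (P t g)) x| ≤ B * t ^ (-a) * ‖k‖ * ‖l‖ ∧
      ∀ κ ∈ Icc (0 : ℝ) 1,
        |fwdDiff k (fwdDiff l (P t g)) x| ≤ B * t ^ (-(a * κ)) * ‖k‖ ^ κ * ‖l‖ ∧
        |fwdDiff h (fwdDiff k (fwdDiff l (P t g))) x| ≤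
          B * t ^ (-(a * (κ + 1))) * ‖h‖ ^ κ * ‖k‖ * ‖l‖ := by
  obtain ⟨B, hB, hsm⟩ := hP.exists_fwdDiff_le_of_holder hc (β := 1) (by simp)
  -- The case `β = 1` of the Hölder estimate, interpolated with the trivial bound of a difference by
  -- twice the sup, whence the `2`.
  refine ⟨2 * (B * K), by positivity, ?_⟩
  rintro t ⟨ht, htT⟩ h k l x
  have hs := fun h k l x => hsm ht htT hg hK (by simpa using hlip) h k l x
  have e1 : -(a * ((1 : ℝ) - 1)) = 0 := by ring
  have e2 : -(a * ((2 : ℝ) - 1)) = -a := by ring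
  have e3 : -(a * ((3 : ℝ) - 1)) = -a + -a := by ring
  simp only [e1, e2, e3, Real.rpow_zero, Real.rpow_add ht] at hs
  have hta : 0 < t ^ (-a) := Real.rpow_pos_of_pos ht _
  have hpow : ∀ (κ : ℝ) (y : Euc d), (t ^ (-a) * ‖y‖) ^ κ = t ^ (-(a * κ)) * ‖y‖ ^ κ := by
    intro κ y
    rw [Real.mul_rpow hta.le (norm_nonneg _), ← Real.rpow_mul ht.le, neg_mul]
  have h2 : ∀ k l x, |fwdDiff k (fwdDiff l (P t g)) x| ≤ B * K * t ^ (-a) * ‖k‖ * ‖l‖ :=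
    fun k l x => ((hs 0 k l x).2.1).trans (le_of_eq (by ring))
  have hself : ∀ y : ℝ, 0 ≤ y → y ≤ 2 * y := fun y hy => by linarith
  refine ⟨(h2 k l x).trans ?_, fun κ hκ => ⟨?_, ?_⟩⟩
  · exact (hself _ (by positivity)).trans_eq (by ring)
  · have := le_mul_rpow_of_le hκ (abs_nonneg _) (D := 2 * (B * K * ‖l‖)) (y := t ^ (-a) * ‖k‖)
      (by positivity) (abs_fwdDiff_le_two_mul (fun y => ((hs 0 0 l y).1).trans
        (le_of_eq (by ring))) k x)
      ((h2 k l x).trans ((hself _ (by positivity)).trans_eq (by ring)))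
    rw [hpow] at this
    exact this.trans (le_of_eq (by ring))
  · have := le_mul_rpow_of_le hκ (abs_nonneg _) (D := 2 * (B * K * t ^ (-a) * ‖k‖ * ‖l‖))
      (y := t ^ (-a) * ‖h‖) (by positivity) (abs_fwdDiff_le_two_mul (h2 k l) h x)
      (((hs h k l x).2.2).trans ((hself _ (by positivity)).trans_eq (by ring)))
    rw [hpow] at this
    refine this.trans (le_of_eq ?_)
    have e4 : -(a * (κ + 1)) = -a + -(a * κ) := by ring
    rw [e4, Real.rpow_add ht]
    ring

/-- A source that is Hölder continuous up to the gradient of the solution forces Hölder continuity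
of the gradient. -/
lemma exists_holder_fderiv (hP : IsSmoothingSemigroup P T a c) (hc : 0 < c) (hT : 0 < T)
    (ha : a ∈ Ioo (0 : ℝ) 1) (hβ : β ∈ Icc (0 : ℝ) 1) {C₀ K M F N L : ℝ} {u₀ : Euc d → ℝ}
    (hu₀ : BddCont C₀ u₀) (hK : 0 ≤ K) (hlip : ∀ h x, |fwdDiff h u₀ x| ≤ K * ‖h‖)
    {u f : ℝ → Euc d → ℝ} (hu : ∀ t ∈ Ioc 0 T, Differentiable ℝ (u t))
    (hM : ∀ t ∈ Ioc 0 T, ∀ x, ‖fderiv ℝ (u t) x‖ ≤ M) (hN : 0 ≤ N) (hL : 0 ≤ L)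
    (hF : ∀ s ∈ Ioo 0 T, BddCont F (f s))
    (hf : ∀ s ∈ Ioo 0 T, ∀ h x,
      |fwdDiff h (f s) x| ≤ N * ‖h‖ ^ β + L * ‖fwdDiff h (fderiv ℝ (u s)) x‖)
    (hduh : ∀ t ∈ Ioc 0 T, DuhamelAt t (u t) (P t u₀) fun s => P (t - s) (f s)) :
    ∃ C, 0 ≤ C ∧ ∀ t ∈ Ioc 0 T, ∀ h x,
      ‖fwdDiff h (fderiv ℝ (u t)) x‖ ≤ C * t ^ (-(a * β)) * ‖h‖ ^ β := by
  set b := a * β with hb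
  have hb0 : 0 ≤ b := mul_nonneg ha.1.le hβ.1
  have hb1 : b < 1 := (mul_le_of_le_one_right ha.1.le hβ.2).trans_lt ha.2
  obtain ⟨B, hB, hlipB⟩ := hP.exists_fwdDiff_le_of_lipschitz hc hu₀ hK hlip
  obtain ⟨D, ε, hD, hε, hint⟩ := exists_abs_integral_le_exp (a := a) (b := b)
    ⟨ha.1.le, ha.2⟩ ⟨hb0, hb1⟩ hT
  have hM0 : 0 ≤ M := (norm_nonneg _).trans (hM T ⟨hT, le_rfl⟩ 0)
  -- Chosen so that `l ^ (-ε) = 1 / q`: the feedback constant `c * L * D * l ^ (-ε)` is then at most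
  -- `1 / 2`.
  set q := 2 * (c * (1 + L) * D) with hq
  have hq0 : 0 < q := by positivity
  set l := q ^ (1 / ε) with hl
  have hl0 : 0 < l := Real.rpow_pos_of_pos hq0 _
  have hlε : l ^ (-ε) = q⁻¹ := by
    rw [hl, ← Real.rpow_mul hq0.le, ← Real.rpow_neg_one]
    congr 1
    field_simp
  set ω : ℝ → ℝ := fun s => Real.exp (l * s) * s ^ (-b) with hω
  have hω0 : ∀ s ∈ Ioc 0 T, 0 ≤ ω s := fun s hs => by
    have := hs.1
    positivity
  have hω1 : ∀ s ∈ Ioc 0 T, 1 ≤ T ^ b * ω s := by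
    intro s hs
    have hs0 := hs.1
    have h1 : 1 ≤ Real.exp (l * s) := Real.one_le_exp (by positivity)
    have h2 : 1 ≤ T ^ b * s ^ (-b) := by
      rw [Real.rpow_neg hs0.le, ← div_eq_mul_inv, one_le_div (by positivity)]
      exact Real.rpow_le_rpow hs0.le hs.2 hb0
    calc (1 : ℝ) ≤ Real.exp (l * s) * (T ^ b * s ^ (-b)) := one_le_mul_of_one_le_of_one_le h1 h2
      _ = _ := by rw [hω]; ring
  set G := B + N * T ^ b with hG
  have hTb : 0 < T ^ b := Real.rpow_pos_of_pos hT b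
  have hG0 : 0 ≤ G := by positivity
  refine ⟨2 * G * Real.exp (l * T), by positivity, ?_⟩
  intro t ht h x
  -- Here `h` is fixed and the absorption runs over `(s, y)`. The a priori bound `W₀`, from
  -- boundedness of `Du`, carries no power of `‖h‖` but drops out of the result; `l` does not depend
  -- on `h`.
  have key := le_two_mul_of_improve (X := Euc d) (T := T) (ω := ω) (A := G * ‖h‖ ^ β)
    (W₀ := 2 * M * T ^ b) (w := fun s y => ‖fwdDiff h (fderiv ℝ (u s)) y‖) hω0 (by positivity)
    (by positivity) ?_ ?_ t ht x
  · refine key.trans ?_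
    have ht0 := ht.1
    calc _ = 2 * (G * ‖h‖ ^ β) * (Real.exp (l * t) * t ^ (-b)) := by rw [hω]
      _ ≤ 2 * (G * ‖h‖ ^ β) * (Real.exp (l * T) * t ^ (-b)) := by gcongr; exact ht.2
      _ = _ := by ring
  · intro s hs y
    calc ‖fwdDiff h (fderiv ℝ (u s)) y‖ ≤ ‖fderiv ℝ (u s) (y + h)‖ + ‖fderiv ℝ (u s) y‖ :=
          norm_sub_le _ _
      _ ≤ 2 * M * 1 := by linarith [hM s hs (y + h), hM s hs y]
      _ ≤ 2 * M * (T ^ b * ω s) := by gcongr; exact hω1 s hs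
      _ = _ := by ring
  · intro W hW hwW t ht x
    have ht0 := ht.1
    refine norm_fwdDiff_fderiv_le (hu t ht) (mul_nonneg (by positivity) (hω0 t ht)) fun k => ?_
    have hR : 0 ≤ N * T ^ b * ‖h‖ ^ β + L * W := by positivity
    have h1 : |fwdDiff k (fwdDiff h (P t u₀)) x| ≤ B * ‖h‖ ^ β * ω t * ‖k‖ := by
      have h2 := ((hlipB t ht 0 h k x).2 β hβ).1
      rw [fwdDiff_comm] at h2
      refine h2.trans ?_
      have h3 : t ^ (-b) ≤ ω t :=
        le_mul_of_one_le_left (by positivity) (Real.one_le_exp (by positivity))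
      calc B * t ^ (-b) * ‖h‖ ^ β * ‖k‖ ≤ B * ω t * ‖h‖ ^ β * ‖k‖ := by gcongr
        _ = _ := by ring
    have h2 := hint (t := t) (l := l) (K := c * (N * T ^ b * ‖h‖ ^ β + L * W) * ‖k‖)
      (φ := fun s => fwdDiff k (fwdDiff h (P (t - s) (f s))) x) ht0 ht.2 (by positivity) hl0 ?_
    · refine (((hduh t ht).fwdDiff h).fwdDiff k).abs_le h1 h2 |>.trans ?_
      have h3 : c * (N * T ^ b * ‖h‖ ^ β + L * W) * (D * l ^ (-ε)) ≤
          N * T ^ b * ‖h‖ ^ β + W / 2 := by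
        rw [hlε, ← mul_assoc, ← div_eq_mul_inv, div_le_iff₀ hq0, hq]
        have h4 : 0 ≤ c * D * W := by positivity
        have h5 : 0 ≤ c * D * (N * T ^ b * ‖h‖ ^ β) := by positivity
        have h6 : 0 ≤ L * (c * D * (N * T ^ b * ‖h‖ ^ β)) := by positivity
        nlinarith
      have h4 := hω0 t ht
      calc _ = ((B * ‖h‖ ^ β) + c * (N * T ^ b * ‖h‖ ^ β + L * W) * (D * l ^ (-ε))) * ω t * ‖k‖ := by
            rw [hω]; ring
        _ ≤ ((B * ‖h‖ ^ β) + (N * T ^ b * ‖h‖ ^ β + W / 2)) * ω t * ‖k‖ := by gcongr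
        _ = _ := by rw [hG]; ring
    · intro s hs
      have hsT : s ∈ Ioo 0 T := ⟨hs.1, hs.2.trans_le ht.2⟩
      have hts : 0 < t - s := sub_pos.2 hs.2
      have hωs := hω1 s ⟨hsT.1, hsT.2.le⟩
      have h3 : BddCont ((N * T ^ b * ‖h‖ ^ β + L * W) * ω s) (fwdDiff h (f s)) := by
        refine ⟨((hF s hsT).fwdDiff h).1, fun y => (hf s hsT h y).trans ?_⟩
        have h4 := hwW s ⟨hsT.1, hsT.2.le⟩ y
        calc N * ‖h‖ ^ β + L * ‖fwdDiff h (fderiv ℝ (u s)) y‖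
            ≤ N * ‖h‖ ^ β * (T ^ b * ω s) + L * (W * ω s) := by
              refine add_le_add (le_mul_of_one_le_right (by positivity) hωs) ?_
              gcongr
          _ = _ := by ring
      rw [← hP.map_fwdDiff h hts (hF s hsT)]
      refine (hP.gain hts (by linarith [hs.1, ht.2]) h3 k x).trans (le_of_eq ?_)
      rw [hω]
      ring

section Schauder

variable {C₀ K F N : ℝ} {u₀ : Euc d → ℝ} {u f : ℝ → Euc d → ℝ}

/-- First order Schauder estimate for the Duhamel formula. -/
lemma exists_schauder_one (hP : IsSmoothingSemigroup P T a c) (hc : 0 < c) (hT : 0 < T)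
    (ha : a ∈ Ioo (0 : ℝ) 1) (hβ : β ∈ Icc (0 : ℝ) 1) (hu₀ : BddCont C₀ u₀) (hK : 0 ≤ K)
    (hlip : ∀ h x, |fwdDiff h u₀ x| ≤ K * ‖h‖) (hN : 0 ≤ N)
    (hF : ∀ s ∈ Ioo 0 T, BddCont F (f s))
    (hf : ∀ s ∈ Ioo 0 T, ∀ h x, |fwdDiff h (f s) x| ≤ N * s ^ (-(a * β)) * ‖h‖ ^ β)
    (hduh : ∀ t ∈ Ioc 0 T, DuhamelAt t (u t) (P t u₀) fun s => P (t - s) (f s))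
    {κ : ℝ} (hκ : κ = (1 - a * (1 - β)) / a) (hκ1 : κ < 1) :
    ∃ C, 0 ≤ C ∧ ∀ t ∈ Ioc 0 T, ∀ h k x,
      |fwdDiff h (fwdDiff k (u t)) x| ≤ C * t ^ (-(a * κ)) * ‖h‖ ^ κ * ‖k‖ := by
  have ha0 := ha.1
  have hκa : a * κ = 1 - a * (1 - β) := by rw [hκ]; field_simp
  have hβa : a * (1 - β) ≤ a := mul_le_of_le_one_right ha0.le (by linarith [hβ.1])
  have hκ0 : 0 ≤ κ := by
    rw [hκ]; exact div_nonneg (by linarith [ha.2]) ha0.le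
  obtain ⟨B, hB, hlipB⟩ := hP.exists_fwdDiff_le_of_lipschitz hc hu₀ hK hlip
  obtain ⟨S, hS, hsm⟩ := hP.exists_fwdDiff_le_of_holder hc hβ
  -- A second difference has the bounds `(t - s) ^ (-(a * (1 - β)))` and `‖h‖ * (t - s) ^ (-(a * (2
  -- - β)))`. Non-integrability of the latter is exactly `κ < 1`.
  obtain ⟨D, hD, hint⟩ := exists_abs_integral_le_min (a := a * (1 - β)) (b := a * β) (e := a)
    ⟨mul_nonneg ha0.le (by linarith [hβ.2]), by linarith [ha.2]⟩
    ⟨mul_nonneg ha0.le hβ.1, (mul_le_of_le_one_right ha0.le hβ.2).trans_lt ha.2⟩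
    (by nlinarith)
  have hTp : 0 < T ^ (a * κ - a * β) := Real.rpow_pos_of_pos hT _
  refine ⟨B + 2 * S * N * D * T ^ (a * κ - a * β), by positivity, ?_⟩
  intro t ht h k x
  have ht0 := ht.1
  rcases eq_or_ne h 0 with rfl | hh
  · have h0 : fwdDiff (0 : Euc d) (fwdDiff k (u t)) x = 0 := by simp [fwdDiff]
    rw [h0, abs_zero]
    positivity
  have h1 := ((hlipB t ht 0 h k x).2 κ ⟨hκ0, hκ1.le⟩).1
  have h2 := hint (t := t) (K := 2 * S * N * ‖k‖) (η := ‖h‖)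
    (φ := fun s => fwdDiff h (fwdDiff k (P (t - s) (f s))) x) ht0 (by positivity)
    (norm_pos_iff.2 hh) ?_
  · refine (((hduh t ht).fwdDiff k).fwdDiff h).abs_le h1 h2 |>.trans ?_
    rw [← hκ]
    have h3 : t ^ (-(a * β)) ≤ T ^ (a * κ - a * β) * t ^ (-(a * κ)) :=
      rpow_neg_le_mul_rpow_neg ht0 ht.2 (by rw [hκa]; linarith [ha.2])
    calc _ ≤ B * t ^ (-(a * κ)) * ‖h‖ ^ κ * ‖k‖ + 2 * S * N * ‖k‖ * D * ‖h‖ ^ κ *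
          (T ^ (a * κ - a * β) * t ^ (-(a * κ))) := by gcongr
      _ = _ := by ring
  · intro s hs
    have hsT : s ∈ Ioo 0 T := ⟨hs.1, hs.2.trans_le ht.2⟩
    have hs0 := hs.1
    have hts : 0 < t - s := sub_pos.2 hs.2
    have h3 := fun h k x => hsm hts (by linarith [hs.1, ht.2]) (hF s hsT)
      (K := N * s ^ (-(a * β))) (by positivity) (hf s hsT) 0 h k x
    constructor
    · refine (abs_fwdDiff_le_two_mul (fun y => (h3 0 k y).1) h x).trans (le_of_eq ?_)
      ring
    · have h4 := (h3 h k x).2.1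
      have e : -(a * (1 - β) + a) = -(a * (2 - β)) := by ring
      rw [e]
      refine h4.trans ?_
      calc _ = 1 * (S * N * ‖k‖ * (s ^ (-(a * β)) * (‖h‖ * (t - s) ^ (-(a * (2 - β)))))) := by ring
        _ ≤ 2 * (S * N * ‖k‖ * (s ^ (-(a * β)) * (‖h‖ * (t - s) ^ (-(a * (2 - β)))))) := by
          gcongr; norm_num
        _ = _ := by ring

/-- Second order Schauder estimate for the Duhamel formula. -/
lemma exists_schauder_two (hP : IsSmoothingSemigroup P T a c) (hc : 0 < c) (hT : 0 < T)
    (ha : a ∈ Ioo (0 : ℝ) 1) (hβ : β ∈ Icc (0 : ℝ) 1) (hu₀ : BddCont C₀ u₀) (hK : 0 ≤ K)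
    (hlip : ∀ h x, |fwdDiff h u₀ x| ≤ K * ‖h‖) (hN : 0 ≤ N)
    (hF : ∀ s ∈ Ioo 0 T, BddCont F (f s))
    (hf : ∀ s ∈ Ioo 0 T, ∀ h x, |fwdDiff h (f s) x| ≤ N * s ^ (-(a * β)) * ‖h‖ ^ β)
    (hduh : ∀ t ∈ Ioc 0 T, DuhamelAt t (u t) (P t u₀) fun s => P (t - s) (f s))
    {κ : ℝ} (hκ : κ = (1 - a * (2 - β)) / a) (hκ0 : 0 < κ) (hκ1 : κ < 1) :
    ∃ C, 0 ≤ C ∧ ∀ t ∈ Ioc 0 T, ∀ h k l x,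
      |fwdDiff k (fwdDiff l (u t)) x| ≤ C * t ^ (-a) * ‖k‖ * ‖l‖ ∧
      |fwdDiff h (fwdDiff k (fwdDiff l (u t))) x| ≤
        C * t ^ (-(a * (κ + 1))) * ‖h‖ ^ κ * ‖k‖ * ‖l‖ := by
  have ha0 := ha.1
  have hκa : a * κ = 1 - a * (2 - β) := by rw [hκ]; field_simp
  have haκ : 0 < a * κ := mul_pos ha0 hκ0
  have haβ0 : 0 ≤ a * β := mul_nonneg ha0.le hβ.1
  have haβ1 : a * β < 1 := (mul_le_of_le_one_right ha0.le hβ.2).trans_lt ha.2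
  have haβ2 : 0 ≤ a * (2 - β) := mul_nonneg ha0.le (by linarith [hβ.2])
  obtain ⟨B, hB, hlipB⟩ := hP.exists_fwdDiff_le_of_lipschitz hc hu₀ hK hlip
  obtain ⟨S, hS, hsm⟩ := hP.exists_fwdDiff_le_of_holder hc hβ
  -- Since `κ > 0`, i.e. `a * (2 - β) < 1`, second differences integrate directly; only third
  -- differences need the cut.
  obtain ⟨D₁, hD₁, hint₁⟩ := exists_abs_integral_le_beta (a := a * (2 - β)) (b := a * β)
    ⟨haβ2, by linarith⟩ ⟨haβ0, haβ1⟩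
  obtain ⟨D, hD, hint⟩ := exists_abs_integral_le_min (a := a * (2 - β)) (b := a * β) (e := a)
    ⟨haβ2, by linarith⟩ ⟨haβ0, haβ1⟩ (by nlinarith)
  have hTp : 0 < T ^ (a * (κ + 1) - a * β) := Real.rpow_pos_of_pos hT _
  have hTq : 0 < T ^ (a - (2 * a - 1)) := Real.rpow_pos_of_pos hT _
  set C₂ := S * N * D₁ * T ^ (a - (2 * a - 1)) with hC₂
  set C₃ := 2 * S * N * D * T ^ (a * (κ + 1) - a * β) with hC₃
  have hC₂0 : 0 ≤ C₂ := by positivity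
  have hC₃0 : 0 ≤ C₃ := by positivity
  have hsource : ∀ t ∈ Ioc 0 T, ∀ s ∈ Ioo 0 t, ∀ h k l x,
      |fwdDiff k (fwdDiff l (P (t - s) (f s))) x| ≤
        S * (t - s) ^ (-(a * (2 - β))) * (N * s ^ (-(a * β))) * ‖k‖ * ‖l‖ ∧
      |fwdDiff h (fwdDiff k (fwdDiff l (P (t - s) (f s)))) x| ≤
        S * (t - s) ^ (-(a * (3 - β))) * (N * s ^ (-(a * β))) * ‖h‖ * ‖k‖ * ‖l‖ := by
    intro t ht s hs h k l x
    have hsT : s ∈ Ioo 0 T := ⟨hs.1, hs.2.trans_le ht.2⟩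
    have hs0 := hs.1
    exact (hsm (sub_pos.2 hs.2) (by linarith [hs.1, ht.2]) (hF s hsT)
      (K := N * s ^ (-(a * β))) (by positivity) (hf s hsT) h k l x).2
  refine ⟨B + C₂ + C₃, by positivity, ?_⟩
  intro t ht h k l x
  have ht0 := ht.1
  constructor
  · have h1 := (hlipB t ht 0 k l x).1
    have h2 := hint₁ (t := t) (K := S * N * ‖k‖ * ‖l‖)
      (φ := fun s => fwdDiff k (fwdDiff l (P (t - s) (f s))) x) ht0 (by positivity) ?_
    · refine (((hduh t ht).fwdDiff l).fwdDiff k).abs_le h1 h2 |>.trans ?_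
      have e : 1 - a * (2 - β) - a * β = -(2 * a - 1) := by ring
      have h3 : t ^ (-(2 * a - 1)) ≤ T ^ (a - (2 * a - 1)) * t ^ (-a) :=
        rpow_neg_le_mul_rpow_neg ht0 ht.2 (by linarith [ha.2])
      rw [e]
      calc _ ≤ B * t ^ (-a) * ‖k‖ * ‖l‖ +
            S * N * ‖k‖ * ‖l‖ * D₁ * (T ^ (a - (2 * a - 1)) * t ^ (-a)) := by gcongr
        _ = (B + C₂ + 0) * t ^ (-a) * ‖k‖ * ‖l‖ := by rw [hC₂]; ring
        _ ≤ _ := by gcongr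
    · intro s hs
      refine ((hsource t ht s hs 0 k l x).1).trans (le_of_eq ?_)
      ring
  · rcases eq_or_ne h 0 with rfl | hh
    · have h0 : fwdDiff (0 : Euc d) (fwdDiff k (fwdDiff l (u t))) x = 0 := by simp [fwdDiff]
      rw [h0, abs_zero]
      positivity
    have h1 := ((hlipB t ht h k l x).2 κ ⟨hκ0.le, hκ1.le⟩).2
    have h2 := hint (t := t) (K := 2 * S * N * ‖k‖ * ‖l‖) (η := ‖h‖)
      (φ := fun s => fwdDiff h (fwdDiff k (fwdDiff l (P (t - s) (f s)))) x) ht0 (by positivity)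
      (norm_pos_iff.2 hh) ?_
    · refine ((((hduh t ht).fwdDiff l).fwdDiff k).fwdDiff h).abs_le h1 h2 |>.trans ?_
      rw [← hκ]
      have h3 : t ^ (-(a * β)) ≤ T ^ (a * (κ + 1) - a * β) * t ^ (-(a * (κ + 1))) :=
        rpow_neg_le_mul_rpow_neg ht0 ht.2 (by nlinarith [hβ.2])
      calc _ ≤ B * t ^ (-(a * (κ + 1))) * ‖h‖ ^ κ * ‖k‖ * ‖l‖ +
            2 * S * N * ‖k‖ * ‖l‖ * D * ‖h‖ ^ κ *
              (T ^ (a * (κ + 1) - a * β) * t ^ (-(a * (κ + 1)))) := by gcongr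
        _ = (B + 0 + C₃) * t ^ (-(a * (κ + 1))) * ‖h‖ ^ κ * ‖k‖ * ‖l‖ := by rw [hC₃]; ring
        _ ≤ _ := by gcongr
    · intro s hs
      have hs0 := hs.1
      have hts : 0 < t - s := sub_pos.2 hs.2
      constructor
      · refine (abs_fwdDiff_le_two_mul (fun y => (hsource t ht s hs 0 k l y).1) h x).trans
          (le_of_eq ?_)
        ring
      · have h4 := (hsource t ht s hs h k l x).2
        have e : -(a * (2 - β) + a) = -(a * (3 - β)) := by ring
        rw [e]
        refine h4.trans ?_
        calc _ = 1 * (S * N * ‖k‖ * ‖l‖ *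
              (s ^ (-(a * β)) * (‖h‖ * (t - s) ^ (-(a * (3 - β)))))) := by ring
          _ ≤ 2 * (S * N * ‖k‖ * ‖l‖ *
              (s ^ (-(a * β)) * (‖h‖ * (t - s) ^ (-(a * (3 - β)))))) := by
            gcongr; norm_num
          _ = _ := by ring

end Schauder

end IsSmoothingSemigroup

end Duhamel

/-! ### The Hamiltonian as a Hölder source. -/

section Hamiltonian

variable {d : ℕ} {T β : ℝ} {H : ℝ → Euc d → Euc d → ℝ}

lemma norm_le_of_supNorm_le {F : Type*} [NormedAddCommGroup F] {f : Euc d → F} {M : ℝ≥0}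
    (h : supNorm f ≤ M) (x : Euc d) : ‖f x‖ ≤ M := by
  have h1 : ‖f x‖ₑ ≤ M := (le_iSup (fun x => ‖f x‖ₑ) x).trans h
  rw [← ofReal_norm] at h1
  simpa using ENNReal.toReal_mono ENNReal.coe_ne_top h1

lemma norm_fderiv_le_of_cbNorm_le {f : Euc d → ℝ} {M : ℝ≥0} (h : cbNorm 1 f ≤ M) (x : Euc d) :
    ‖fderiv ℝ f x‖ ≤ M := by
  rw [← norm_iteratedFDeriv_one]
  refine norm_le_of_supNorm_le (le_trans ?_ h) x
  rw [cbNorm, Finset.sum_range_succ]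
  exact le_add_self

lemma norm_gradient (f : Euc d → ℝ) (x : Euc d) : ‖gradient f x‖ = ‖fderiv ℝ f x‖ := by
  rw [gradient, LinearIsometryEquiv.norm_map]

lemma norm_gradient_sub_gradient (f : Euc d → ℝ) (x y : Euc d) :
    ‖gradient f x - gradient f y‖ = ‖fderiv ℝ f x - fderiv ℝ f y‖ := by
  rw [← dist_eq_norm, ← dist_eq_norm, gradient, gradient, LinearIsometryEquiv.dist_map]

/-- Bounds for the source `y ↦ H(s, y, Du(s, y))` in terms of a gradient bound for `u`. -/
lemma exists_source_bounds (hHp : HamiltonianLipschitz T H) (hHx : HamiltonianHolder T β H)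
    (hβ : 0 ≤ β) (M : ℝ≥0) :
    ∃ F N L : ℝ, 0 ≤ N ∧ 0 ≤ L ∧ ∀ s ∈ Ioo 0 T, ∀ v : Euc d → ℝ, ContDiff ℝ 1 v →
      (∀ x, ‖fderiv ℝ v x‖ ≤ M) →
      BddCont F (fun y => H s y (gradient v y)) ∧ ∀ h x,
        |fwdDiff h (fun y => H s y (gradient v y)) x| ≤
          N * ‖h‖ ^ β + L * ‖fwdDiff h (fderiv ℝ v) x‖ := by
  have hR : (0 : ℝ) < M + 1 := by positivity
  obtain ⟨H₀, L, hH₀, hL, hb⟩ := hHp.bounds (M + 1) hR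
  obtain ⟨N, hN, hx⟩ := hHx (M + 1) hR
  -- The radius `M + 1` puts all gradients in the open ball. The term `2 * (H₀ + L * M)` covers `‖h‖
  -- ≥ 1`, where the Hölder assumption is silent.
  refine ⟨H₀ + L * M, N + 2 * (H₀ + L * M), L, by positivity, hL.le, ?_⟩
  intro s hs v hv hvM
  have hmem : ∀ x, gradient v x ∈ Metric.ball (0 : Euc d) (M + 1) := by
    intro x
    rw [mem_ball_zero_iff, norm_gradient]
    linarith [hvM x]
  have hbound : ∀ x y, |H s x (gradient v y)| ≤ H₀ + L * M := by
    intro x y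
    obtain ⟨h0, h1⟩ := hb s hs x
    have h2 := h1 _ (hmem y) 0 (by simpa using hR)
    rw [sub_zero, norm_gradient] at h2
    have h3 : L * ‖fderiv ℝ v y‖ ≤ L * M := by gcongr; exact hvM y
    have h4 := abs_add_le (H s x (gradient v y) - H s x 0) (H s x 0)
    rw [sub_add_cancel] at h4
    linarith
  refine ⟨⟨?_, fun y => hbound y y⟩, fun h x => ?_⟩
  · have hg : Continuous (gradient v) :=
      (InnerProductSpace.toDual ℝ (Euc d)).symm.continuous.comp (hv.continuous_fderiv one_ne_zero)
    exact hHp.continuousOn.comp_continuous (f := fun y => (s, y, gradient v y)) (by fun_prop)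
      fun y => ⟨⟨hs.1.le, hs.2.le⟩, mem_univ _⟩
  · have h1 : |H s (x + h) (gradient v (x + h)) - H s (x + h) (gradient v x)| ≤
        L * ‖fwdDiff h (fderiv ℝ v) x‖ := by
      rw [fwdDiff, ← norm_gradient_sub_gradient]
      exact (hb s hs (x + h)).2 _ (hmem _) _ (hmem _)
    have h2 : |H s (x + h) (gradient v x) - H s x (gradient v x)| ≤
        (N + 2 * (H₀ + L * M)) * ‖h‖ ^ β := by
      rcases lt_or_ge ‖h‖ 1 with hh | hh
      · have h3 := hx s ⟨hs.1.le, hs.2.le⟩ _ (hmem x) (x + h) x (by simpa using hh)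
        rw [add_sub_cancel_left] at h3
        refine h3.trans ?_
        gcongr
        exact le_add_of_nonneg_right (by positivity)
      · have h3 : 1 ≤ ‖h‖ ^ β := Real.one_le_rpow hh hβ
        have h4 := abs_sub (H s (x + h) (gradient v x)) (H s x (gradient v x))
        have h5 := hbound (x + h) x
        have h6 := hbound x x
        have h7 : 0 ≤ H₀ + L * M := by positivity
        calc _ ≤ (N + 2 * (H₀ + L * M)) * 1 := by linarith
          _ ≤ _ := by gcongr
    have h3 := abs_add_le (H s (x + h) (gradient v (x + h)) - H s (x + h) (gradient v x))
      (H s (x + h) (gradient v x) - H s x (gradient v x))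
    rw [sub_add_sub_cancel] at h3
    rw [fwdDiff]
    linarith

end Hamiltonian

/-! ### Assembling the theorem. -/

lemma bigOAtZero_of_le {F : ℝ → ℝ≥0∞} {g : ℝ → ℝ} {T C : ℝ} (hT : 0 < T) (hC : 0 ≤ C)
    (h : ∀ t ∈ Ioc 0 T, F t ≤ ENNReal.ofReal (C * g t)) : BigOAtZero F g := by
  refine ⟨C.toNNReal, ?_⟩
  filter_upwards [Ioc_mem_nhdsGT hT] with t ht
  refine (h t ht).trans (le_of_eq ?_)
  rw [ENNReal.ofReal_mul hC]
  rfl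

theorem mainTheorem1 (d : ℕ) (hd : 1 ≤ d)
    (A : Matrix (Fin d) (Fin d) ℝ) (hA : A.PosSemidef)
    (μ : Measure (Euc d)) (hμ : IsLevyMeasure μ)
    (T α β : ℝ) (hT : 0 < T) (hα : α ∈ Ioc (1 : ℝ) 2) (hβ : β ∈ Icc (0 : ℝ) 1)
    (hαβ : ∀ n : ℕ, α + β ≠ n)
    (hL : NondegenerateOfOrder A μ T α)
    (H : ℝ → Euc d → Euc d → ℝ)
    (hHp : HamiltonianLipschitz T H) (hHx : HamiltonianHolder T β H)
    (u₀ : Euc d → ℝ) (hu₀_bdd : ∃ C : ℝ, ∀ x, |u₀ x| ≤ C)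
    (hu₀_lip : ∃ K : ℝ≥0, LipschitzWith K u₀)
    (u : ℝ → Euc d → ℝ) (hu : IsBoundedContinuousCbOne T u)
    (hmild : IsMildSolution A μ T H u₀ u) :
    (∀ t ∈ Ioc (0 : ℝ) T, IsCbHolder (α + β) (u t)) ∧
    BigOAtZero
      (fun t => holderSeminorm (Int.fract (α + β)) (iteratedFDeriv ℝ ⌊α + β⌋₊ (u t)))
      (fun t => t ^ (-((α + β - 1) / α))) ∧
    (2 < α + β →
      BigOAtZero (fun t => supNorm (iteratedFDeriv ℝ 2 (u t))) (fun t => t ^ (-(1 / α)))) := by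
  obtain ⟨c, hc, hP⟩ := hL.isSmoothingSemigroup
  obtain ⟨C₀, hC₀⟩ := hu₀_bdd
  obtain ⟨K, hK⟩ := hu₀_lip
  obtain ⟨⟨hCb, -⟩, M, hM⟩ := hu
  have hα0 : 0 < α := by linarith [hα.1]
  have ha : 1 / α ∈ Ioo (0 : ℝ) 1 := ⟨by positivity, by rw [div_lt_one hα0]; exact hα.1⟩
  have hu₀ : BddCont C₀ u₀ := ⟨hK.continuous, hC₀⟩
  have hlip : ∀ h x, |fwdDiff h u₀ x| ≤ K * ‖h‖ := fun h x => by
    simpa [fwdDiff, dist_eq_norm] using hK.dist_le_mul (x + h) x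
  have hdiff : ∀ t ∈ Ioc 0 T, Differentiable ℝ (u t) := fun t ht =>
    (hCb t ht).1.differentiable (by simp)
  have hM' : ∀ t ∈ Ioc 0 T, ∀ x, ‖fderiv ℝ (u t) x‖ ≤ M := fun t ht =>
    norm_fderiv_le_of_cbNorm_le (hM t ht)
  obtain ⟨F, N, L, hN, hL0, hsource⟩ := exists_source_bounds hHp hHx hβ.1 M
  have hF := fun s (hs : s ∈ Ioo 0 T) =>
    (hsource s hs (u s) (hCb s ⟨hs.1, hs.2.le⟩).1 (hM' s ⟨hs.1, hs.2.le⟩)).1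
  have hf := fun s (hs : s ∈ Ioo 0 T) =>
    (hsource s hs (u s) (hCb s ⟨hs.1, hs.2.le⟩).1 (hM' s ⟨hs.1, hs.2.le⟩)).2
  have hduh : ∀ t ∈ Ioc 0 T, DuhamelAt t (u t) (heatSemigroup A μ t u₀) fun s =>
      heatSemigroup A μ (t - s) (fun y => H s y (gradient (u s) y)) :=
    fun t ht => ⟨hmild.integrable t ht, hmild.duhamel t ht⟩
  obtain ⟨D, hD, hDu⟩ := hP.exists_holder_fderiv hc hT ha hβ hu₀ K.coe_nonneg hlip hdiff hM' hN
    hL0 (f := fun s y => H s y (gradient (u s) y)) hF hf hduh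
  set b := 1 / α * β with hb
  have hb0 : 0 ≤ b := mul_nonneg ha.1.le hβ.1
  have hTb : 0 < T ^ b := Real.rpow_pos_of_pos hT b
  have hf' : ∀ s ∈ Ioo 0 T, ∀ h x, |fwdDiff h (fun y => H s y (gradient (u s) y)) x| ≤
      (N * T ^ b + L * D) * s ^ (-b) * ‖h‖ ^ β := by
    intro s hs h x
    have hs0 := hs.1
    have h1 : 1 ≤ T ^ b * s ^ (-b) := by
      simpa using rpow_neg_le_mul_rpow_neg hs0 hs.2.le hb0
    calc _ ≤ N * ‖h‖ ^ β + L * ‖fwdDiff h (fderiv ℝ (u s)) x‖ := hf s hs h x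
      _ ≤ N * ‖h‖ ^ β * (T ^ b * s ^ (-b)) + L * (D * s ^ (-b) * ‖h‖ ^ β) := by
        refine add_le_add (le_mul_of_one_le_right (by positivity) h1) ?_
        gcongr
        exact hDu s ⟨hs0, hs.2.le⟩ h x
      _ = _ := by ring
  have hN' : 0 ≤ N * T ^ b + L * D := by positivity
  have hpos : 1 < α + β := by linarith [hα.1, hβ.1]
  have hfloor : (⌊α + β⌋₊ : ℝ) + Int.fract (α + β) = α + β := by
    rw [natCast_floor_eq_intCast_floor (by linarith), Int.floor_add_fract]
  -- As `1 < α + β ≤ 3` and `α + β` is not an integer, the floor is `1` or `2` and `κ` lies strictly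
  -- between `0` and `1`.
  rcases lt_or_ge (α + β) 2 with h2 | h2
  · have hn : ⌊α + β⌋₊ = 1 := by
      rw [Nat.floor_eq_iff (by linarith)]
      norm_num
      exact ⟨hpos.le, h2⟩
    have hfr : Int.fract (α + β) = α + β - 1 := by
      rw [hn] at hfloor
      push_cast at hfloor
      linarith
    obtain ⟨C, hC, hreg⟩ := hP.exists_schauder_one hc hT ha hβ hu₀ K.coe_nonneg hlip hN' hF hf'
      hduh (κ := α + β - 1) (by field_simp; ring) (by linarith)
    have hhol : ∀ t ∈ Ioc 0 T, holderSeminorm (Int.fract (α + β))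
        (iteratedFDeriv ℝ ⌊α + β⌋₊ (u t)) ≤
          ENNReal.ofReal (C * t ^ (-((α + β - 1) / α))) := by
      intro t ht
      have ht0 := ht.1
      rw [hn, hfr]
      refine holderSeminorm_iteratedFDeriv_one_le (hdiff t ht) (by positivity) fun k l x => ?_
      have e : -((α + β - 1) / α) = -(1 / α * (α + β - 1)) := by ring
      rw [e]
      exact hreg t ht k l x
    refine ⟨fun t ht => ⟨?_, fun _ => (hhol t ht).trans_lt ENNReal.ofReal_lt_top⟩,
      bigOAtZero_of_le hT hC hhol, fun h => absurd h (by linarith)⟩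
    rw [hn]
    exact hCb t ht
  · have h2' : 2 < α + β := lt_of_le_of_ne h2 fun h => hαβ 2 (by exact_mod_cast h.symm)
    have h3 : α + β < 3 := lt_of_le_of_ne (by linarith [hα.2, hβ.2]) fun h =>
      hαβ 3 (by exact_mod_cast h)
    have hn : ⌊α + β⌋₊ = 2 := by
      rw [Nat.floor_eq_iff (by linarith)]
      norm_num
      exact ⟨h2, by linarith⟩
    have hfr : Int.fract (α + β) = α + β - 2 := by
      rw [hn] at hfloor
      push_cast at hfloor
      linarith
    obtain ⟨C, hC, hreg⟩ := hP.exists_schauder_two hc hT ha hβ hu₀ K.coe_nonneg hlip hN' hF hf'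
      hduh (κ := α + β - 2) (by field_simp; ring) (by linarith) (by linarith)
    have hall : ∀ t ∈ Ioc 0 T, ContDiff ℝ 2 (u t) ∧
        supNorm (iteratedFDeriv ℝ 2 (u t)) ≤ ENNReal.ofReal (C * t ^ (-(1 / α))) ∧
        holderSeminorm (α + β - 2) (iteratedFDeriv ℝ 2 (u t)) ≤
          ENNReal.ofReal (C * t ^ (-((α + β - 1) / α))) := by
      intro t ht
      have ht0 := ht.1
      have e : -((α + β - 1) / α) = -(1 / α * (α + β - 2 + 1)) := by ring
      rw [e]
      exact regularity_of_fwdDiff_le (hdiff t ht) (by positivity) (by positivity) (by linarith)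
        (fun k l x => (hreg t ht 0 k l x).1) (fun h k l x => (hreg t ht h k l x).2)
    refine ⟨fun t ht => ?_, bigOAtZero_of_le hT hC fun t ht => ?_,
      fun _ => bigOAtZero_of_le hT hC fun t ht => (hall t ht).2.1⟩
    · obtain ⟨hcd, hsup, hhol⟩ := hall t ht
      rw [IsCbHolder, hn, hfr]
      refine ⟨⟨hcd, ?_⟩, fun _ => hhol.trans_lt ENNReal.ofReal_lt_top⟩
      -- Orders `0` and `1` are bounded by hypothesis; only the second derivative is new.
      rw [cbNorm, Finset.sum_range_succ]
      exact ENNReal.add_lt_top.2 ⟨(hCb t ht).2, hsup.trans_lt ENNReal.ofReal_lt_top⟩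
    · rw [hn, hfr]
      exact (hall t ht).2.2
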